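/- For $i=1,2$ let $(M_i,\omega_i)$ be a (finite-dimensional, Hausdorff, second countable, smooth) symplectic manifold, $G_i$ a Lie group with Lie algebra $\mathfrak g_i$ acting smoothly, freely and properly on $M_i$ by symplectic diffeomorphisms, with momentum map $J_i:M_i\to\mathfrak g_i^*$ (that is, $J_i$ is smooth and $\omega_i(\xi_{M_i},\cdot)=d\langle J_i,\xi\rangle$ for every $\xi\in\mathfrak g_i$, where $\xi_{M_i}$ is the infinitesimal generator of $\xi$). Let $\mu_i\in\mathfrak g_i^*$ be such that $G_i$ maps $J_i^{-1}(\mu_i)$ into itself, and let $H_i:M_i\to\mathbb R$ be a smooth $G_i$-invariant function. Let $P_i=J_i^{-1}(\mu_i)/G_i$ be the reduced phase space with projection $\pi_i:J_i^{-1}(\mu_i)\to P_i$; here $J_i^{-1}(\mu_i)$ is regarded as an embedded submanifold of $M_i$, and $P_i$ carries the smooth structure for which $\pi_i$ is a submersion. Let $\omega_{\mu_i}$ be the induced form on $P_i$, i.e. $\pi_i^*\omega_{\mu_i}=\omega_i|_{J_i^{-1}(\mu_i)}$, and let $H_{\mu_i}:P_i\to\mathbb R$ be the induced function. Assume $\dim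 P_1=\dim P_2$. Suppose that $F:J_1^{-1}(\mu_1)\to J_2^{-1}(\mu_2)$ is a smooth map which is equivariant, in the sense that it maps $G_1$-orbits into $G_2$-orbits, and partially symplectic, i.e. $F^*(\omega_2|_{J_2^{-1}(\mu_2)})=\omega_1|_{J_1^{-1}(\mu_1)}$, and that $H_1=H_2\circ F$ on $J_1^{-1}(\mu_1)$. Let $\hat F:P_1\to P_2$ be the induced map. Then the forms $\omega_{\mu_1},\omega_{\mu_2}$ are well defined and nondegenerate, and $\hat F$ is a local diffeomorphism with $\hat F^*\omega_{\mu_2}=\omega_{\mu_1}$. Moreover $\hat F$ takes orbits of the Hamiltonian flow of $H_{\mu_1}$ on $(P_1,\omega_{\mu_1})$ to orbits of the Hamiltonian flow of $H_{\mu_2}$ on $(P_2,\omega_{\mu_2})$: if $\gamma$ is an integral curve of the Hamiltonian vector field of $H_{\mu_1}$ then $\hat F\circ\gamma$ is an integral curve of that of $H_{\mu_2}$, with the same time parametrization. Hence, for every $p\in P_1$, the image under $\hat F$ of the orbit of $p$ is contained in the orbit of $\hat F(p)$, and it is equal to that orbit whenever the integral curve through $p$ is defined for all time. -/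

import Mathlib

open scoped Manifold ContDiff

noncomputable section

section Forms

variable {E : Type*} [NormedAddCommGroup E] [NormedSpace ℝ E]
  {M : Type*} [TopologicalSpace M] [ChartedSpace E M]
  {E' : Type*} [NormedAddCommGroup E'] [NormedSpace ℝ E']
  {N : Type*} [TopologicalSpace N] [ChartedSpace E' N]

/-- A (not necessarily continuous) field of alternating bilinear forms on the tangent spaces of the
boundaryless manifold `M` modelled on `E`. -/
abbrev TwoForm (E : Type*) [NormedAddCommGroup E] [NormedSpace ℝ E]
    (M : Type*) [TopologicalSpace M] [ChartedSpace E M] : Type _ :=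
  ∀ x : M, TangentSpace 𝓘(ℝ, E) x [⋀^Fin 2]→L[ℝ] ℝ

/-- The pullback `f^* Ω`, i.e. `(f^* Ω)_x (u, v) = Ω_{f x} (df_x u, df_x v)`. -/
def pullbackForm (f : M → N) (Ω : TwoForm E' N) : TwoForm E M := fun x =>
  (Ω (f x)).compContinuousLinearMap (mfderiv 𝓘(ℝ, E) 𝓘(ℝ, E') f x)

/-- The expression of `Ω` in the preferred chart at `x₀`: the pullback of `Ω` under the inverse
chart. It is meaningful on the (open) target of the chart. -/
def formInChart (Ω : TwoForm E M) (x₀ : M) : E → E [⋀^Fin 2]→L[ℝ] ℝ :=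
  pullbackForm (E := E) (M := E) (extChartAt 𝓘(ℝ, E) x₀).symm Ω

/-- Pointwise nondegeneracy of a 2-form. -/
def NondegenerateForm (Ω : TwoForm E M) : Prop :=
  ∀ (x : M) (u : TangentSpace 𝓘(ℝ, E) x),
    (∀ v : TangentSpace 𝓘(ℝ, E) x, Ω x ![u, v] = 0) → u = 0

/-- A symplectic form: a smooth, closed, nondegenerate 2-form. -/
structure IsSymplecticForm (Ω : TwoForm E M) : Prop where
  smooth : ∀ x₀ : M, ContDiffOn ℝ ∞ (formInChart Ω x₀) (extChartAt 𝓘(ℝ, E) x₀).target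
  closed : ∀ x₀ : M, ∀ y ∈ (extChartAt 𝓘(ℝ, E) x₀).target, extDeriv (formInChart Ω x₀) y = 0
  nondegenerate : NondegenerateForm Ω

/-- `X` is a Hamiltonian vector of `H` at `x`: `Ω_x (X, ·) = dH_x`. -/
def IsHamiltonianVector (Ω : TwoForm E M) (H : M → ℝ) (x : M)
    (X : TangentSpace 𝓘(ℝ, E) x) : Prop :=
  ∀ w : TangentSpace 𝓘(ℝ, E) x, Ω x ![X, w] = (mfderiv 𝓘(ℝ, E) 𝓘(ℝ, ℝ) H x w : ℝ)

/-- The Hamiltonian vector field of `H` with respect to the (nondegenerate) form `Ω`. -/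
def hamiltonianVectorField (Ω : TwoForm E M) (H : M → ℝ) (x : M) : TangentSpace 𝓘(ℝ, E) x :=
  Classical.epsilon (IsHamiltonianVector Ω H x)

/-- The orbit of `p` under the (local) Hamiltonian flow of `H`: all points `γ t`, where `γ` is an
integral curve of the Hamiltonian vector field, defined on an open interval containing `0` and `t`,
with `γ 0 = p`. -/
def hamiltonianOrbit (Ω : TwoForm E M) (H : M → ℝ) (p : M) : Set M :=
  {q | ∃ (γ : ℝ → M) (a b t : ℝ), (0 : ℝ) ∈ Set.Ioo a b ∧ t ∈ Set.Ioo a b ∧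
    IsMIntegralCurveOn γ (hamiltonianVectorField Ω H) (Set.Ioo a b) ∧ γ 0 = p ∧ γ t = q}

end Forms

section Reduction

/-- The level set `J⁻¹(μ)`, with the subspace topology. -/
abbrev MomentumLevel {M A : Type*} (J : M → A) (μ : A) : Type _ := {x : M // J x = μ}

/-- Two points of `J⁻¹(μ)` are equivalent if they lie in the same `G`-orbit. -/
def levelOrbitSetoid (G : Type*) [Group G] {M A : Type*} [MulAction G M] (J : M → A) (μ : A) :
    Setoid (MomentumLevel J μ) :=
  (MulAction.orbitRel G M).comap Subtype.val

/-- The reduced phase space `P_μ = J⁻¹(μ) / G`, with the quotient topology. -/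
abbrev ReducedSpace (G : Type*) [Group G] {M A : Type*} [MulAction G M] (J : M → A) (μ : A) :
    Type _ :=
  Quotient (levelOrbitSetoid G J μ)

/-- The projection `π : J⁻¹(μ) → P_μ`. -/
def reducedProj (G : Type*) [Group G] {M A : Type*} [MulAction G M] (J : M → A) (μ : A) :
    MomentumLevel J μ → ReducedSpace G J μ :=
  Quotient.mk (levelOrbitSetoid G J μ)

/-- The reduced Hamiltonian `H_μ : P_μ → ℝ` induced by an invariant function `H`. -/
def reducedHamiltonian (G : Type*) [Group G] {M A : Type*} [MulAction G M] (J : M → A) (μ : A)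
    (H : M → ℝ) (hH : ∀ (g : G) (x : M), H (g • x) = H x) : ReducedSpace G J μ → ℝ :=
  Quotient.lift (fun x : MomentumLevel J μ => H x) (by
    rintro x y ⟨g, hg⟩
    have hg' : g • (y : M) = (x : M) := hg
    change H x = H y
    rw [← hg', hH])

/-- `F` maps `G₁`-orbits into `G₂`-orbits. -/
def MapsOrbitsIntoOrbits (G₁ G₂ : Type*) [Group G₁] [Group G₂] {M₁ M₂ A₁ A₂ : Type*}
    [MulAction G₁ M₁] [MulAction G₂ M₂] {J₁ : M₁ → A₁} {μ₁ : A₁} {J₂ : M₂ → A₂} {μ₂ : A₂}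
    (F : MomentumLevel J₁ μ₁ → MomentumLevel J₂ μ₂) : Prop :=
  ∀ x y : MomentumLevel J₁ μ₁, (x : M₁) ∈ MulAction.orbit G₁ (y : M₁) →
    (F x : M₂) ∈ MulAction.orbit G₂ (F y : M₂)

/-- The map of reduced phase spaces induced by `F`. -/
def reducedMap {G₁ G₂ : Type*} [Group G₁] [Group G₂] {M₁ M₂ A₁ A₂ : Type*}
    [MulAction G₁ M₁] [MulAction G₂ M₂] {J₁ : M₁ → A₁} {μ₁ : A₁} {J₂ : M₂ → A₂} {μ₂ : A₂}
    (F : MomentumLevel J₁ μ₁ → MomentumLevel J₂ μ₂) (hF : MapsOrbitsIntoOrbits G₁ G₂ F) :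
    ReducedSpace G₁ J₁ μ₁ → ReducedSpace G₂ J₂ μ₂ :=
  Quotient.lift (fun x => reducedProj G₂ J₂ μ₂ (F x)) fun x y hxy => Quotient.sound (hF x y hxy)

variable {E : Type*} [NormedAddCommGroup E] [NormedSpace ℝ E]
  {M : Type*} [TopologicalSpace M] [ChartedSpace E M]
  {EG : Type*} [NormedAddCommGroup EG] [NormedSpace ℝ EG]
  {G : Type*} [TopologicalSpace G] [ChartedSpace EG G] [Group G] [MulAction G M]

/-- The value at `x` of the infinitesimal generator `ξ_M` of the action: the image of `ξ ∈ 𝔤 = T_1 G`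
under the differential at `1` of `g ↦ g • x`. (Its value lives in `T_{1 • x} M = T_x M`.) -/
def infinitesimalGenerator (ξ : GroupLieAlgebra 𝓘(ℝ, EG) G) (x : M) : TangentSpace 𝓘(ℝ, E) x :=
  mfderiv 𝓘(ℝ, EG) 𝓘(ℝ, E) (fun g : G => g • x) 1 ξ

/-- `(M, Ω)` is a symplectic manifold on which `G` acts freely by symplectic diffeomorphisms with
momentum map `J : M → 𝔤^*`; the action maps the level set `J⁻¹(μ)` into itself and `H` is a smooth
invariant Hamiltonian. (Smoothness of the action, the manifold and Lie group axioms, and properness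
of the action are given by separate type classes.) -/
structure IsHamiltonianSystemWithSymmetry (Ω : TwoForm E M)
    (J : M → Module.Dual ℝ (GroupLieAlgebra 𝓘(ℝ, EG) G))
    (μ : Module.Dual ℝ (GroupLieAlgebra 𝓘(ℝ, EG) G)) (H : M → ℝ) : Prop where
  symplectic : IsSymplecticForm Ω
  free : ∀ (g : G) (x : M), g • x = x → g = 1
  symplectic_action : ∀ g : G, pullbackForm (fun x : M => g • x) Ω = Ω
  momentum_smooth : ∀ ξ : GroupLieAlgebra 𝓘(ℝ, EG) G,
    ContMDiff 𝓘(ℝ, E) 𝓘(ℝ, ℝ) ∞ (fun x => J x ξ)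
  momentum : ∀ (ξ : GroupLieAlgebra 𝓘(ℝ, EG) G) (x : M),
    IsHamiltonianVector Ω (fun y => J y ξ) x (infinitesimalGenerator ξ x)
  level_invariant : ∀ (g : G) (x : M), J x = μ → J (g • x) = μ
  hamiltonian_smooth : ContMDiff 𝓘(ℝ, E) 𝓘(ℝ, ℝ) ∞ H
  hamiltonian_invariant : ∀ (g : G) (x : M), H (g • x) = H x

/-- `P_μ` carries the quotient manifold structure: `J⁻¹(μ)` has the manifold structure of an
embedded submanifold of `M`, and `P_μ` the one for which `π` is a submersion. These two conditions
determine both smooth structures uniquely. -/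
structure IsReducedManifold (E EL EP : Type*) [NormedAddCommGroup E] [NormedSpace ℝ E]
    [NormedAddCommGroup EL] [NormedSpace ℝ EL] [NormedAddCommGroup EP] [NormedSpace ℝ EP]
    (G : Type*) [Group G] {M A : Type*} [TopologicalSpace M] [ChartedSpace E M] [MulAction G M]
    (J : M → A) (μ : A) [ChartedSpace EL (MomentumLevel J μ)]
    [ChartedSpace EP (ReducedSpace G J μ)] : Prop where
  level_manifold : IsManifold 𝓘(ℝ, EL) ∞ (MomentumLevel J μ)
  level_embedded : Manifold.IsSmoothEmbedding 𝓘(ℝ, EL) 𝓘(ℝ, E) ∞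
    (Subtype.val : MomentumLevel J μ → M)
  quotient_manifold : IsManifold 𝓘(ℝ, EP) ∞ (ReducedSpace G J μ)
  proj_submersion : Manifold.IsSubmersion 𝓘(ℝ, EL) 𝓘(ℝ, EP) ∞ (reducedProj G J μ)

/-- The restriction `Ω|_{J⁻¹(μ)}`, i.e. the pullback of `Ω` under the inclusion. -/
def levelForm (EL : Type*) [NormedAddCommGroup EL] [NormedSpace ℝ EL] (Ω : TwoForm E M)
    {A : Type*} (J : M → A) (μ : A) [ChartedSpace EL (MomentumLevel J μ)] :
    TwoForm EL (MomentumLevel J μ) :=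
  pullbackForm (Subtype.val : MomentumLevel J μ → M) Ω

/-- `η` is induced by `Ω` on the reduced phase space: `π^* η = Ω|_{J⁻¹(μ)}`. -/
def IsReducedForm (EL : Type*) [NormedAddCommGroup EL] [NormedSpace ℝ EL]
    {EP : Type*} [NormedAddCommGroup EP] [NormedSpace ℝ EP]
    (G : Type*) [Group G] [MulAction G M] (Ω : TwoForm E M)
    {A : Type*} (J : M → A) (μ : A) [ChartedSpace EL (MomentumLevel J μ)]
    [ChartedSpace EP (ReducedSpace G J μ)] (η : TwoForm EP (ReducedSpace G J μ)) : Prop :=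
  pullbackForm (reducedProj G J μ) η = levelForm EL Ω J μ

/-- The reduced form `Ω_μ`: the 2-form on `P_μ` with `π^* Ω_μ = Ω|_{J⁻¹(μ)}`. -/
def reducedForm (EL EP : Type*) [NormedAddCommGroup EL] [NormedSpace ℝ EL]
    [NormedAddCommGroup EP] [NormedSpace ℝ EP]
    (G : Type*) [Group G] [MulAction G M] (Ω : TwoForm E M)
    {A : Type*} (J : M → A) (μ : A) [ChartedSpace EL (MomentumLevel J μ)]
    [ChartedSpace EP (ReducedSpace G J μ)] : TwoForm EP (ReducedSpace G J μ) :=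
  Classical.epsilon (IsReducedForm EL G Ω J μ)

end Reduction

end

/-! Fix `l` in the level set and let `W` be the space of generator vectors at `l`. By the momentum
equation the differentials of the components of `J` are the pairings of the form with the
generators. The action is free, so the infinitesimal action is injective (`generatorMap_injective`)
and these differentials are independent; by the implicit function theorem the tangent space of the
level set is the symplectic complement of `W` (`IsReducedManifold.exists_val_eq`). As the action is
also proper, a curve inside an orbit lifts to a differentiable curve in the group, so the kernel of
the differential of the projection is `W` (`IsReducedManifold.exists_generator_eq`).

The double complement of `W` is `W`. Hence the kernel of the restricted form is exactly the kernel
of the differential of the projection (`IsReducedManifold.proj_eq_zero_iff`). Together with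
invariance under the group this makes the form descend to the quotient, and the descended form is
nondegenerate.

The projections intertwine `F` with the induced map and are submersions, so the induced map pulls
one reduced form back to the other. Nondegeneracy makes its differentials injective, equality of
dimensions makes them bijective, and the inverse function theorem gives a local diffeomorphism. A
symplectic map with bijective differentials that intertwines the Hamiltonians also relates their
Hamiltonian vector fields, so it carries integral curves to integral curves.

The image of a complete orbit is a whole orbit by uniqueness of integral curves in the target. This
needs a Hausdorff reduced space, which comes from properness (`t2Space_reducedSpace`), and a
continuously differentiable field, which comes from local sections of the projection
(`IsReducedManifold.contMDiff_hamiltonianVectorField`).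

Differentials are treated as maps between model spaces, so that vectors over equal base points can
be compared directly. -/

noncomputable section

section Preliminaries

open scoped Topology
open Filter Set

/-! ### Velocities of curves and differentials. -/

section Velocity

variable {E : Type*} [NormedAddCommGroup E] [NormedSpace ℝ E]
  {M : Type*} [TopologicalSpace M] [ChartedSpace E M]
  {E' : Type*} [NormedAddCommGroup E'] [NormedSpace ℝ E']
  {N : Type*} [TopologicalSpace N] [ChartedSpace E' N]

/-- The derivative of a map of manifolds, as a map between the model spaces. -/
def modelDeriv (E : Type*) [NormedAddCommGroup E] [NormedSpace ℝ E]
    {M : Type*} [TopologicalSpace M] [ChartedSpace E M]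
    (E' : Type*) [NormedAddCommGroup E'] [NormedSpace ℝ E']
    {N : Type*} [TopologicalSpace N] [ChartedSpace E' N] (f : M → N) (x : M) : E →L[ℝ] E' :=
  mfderiv 𝓘(ℝ, E) 𝓘(ℝ, E') f x

/-- The curve `c` has velocity `v` at time `0`. -/
def HasVelocityAt (c : ℝ → M) (v : E) : Prop :=
  HasMFDerivAt 𝓘(ℝ, ℝ) 𝓘(ℝ, E) c 0 ((1 : ℝ →L[ℝ] ℝ).smulRight v)

theorem HasMFDerivAt.hasVelocityAt {c : ℝ → M} {v : E} {L : ℝ →L[ℝ] E}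
    (h : HasMFDerivAt 𝓘(ℝ, ℝ) 𝓘(ℝ, E) c 0 L) (hL : L 1 = v) : HasVelocityAt c v := by
  have e : (1 : ℝ →L[ℝ] ℝ).smulRight v = L := by ext; simp [hL]
  unfold HasVelocityAt
  exact e ▸ h

theorem HasVelocityAt.continuousAt {c : ℝ → M} {v : E} (h : HasVelocityAt c v) :
    ContinuousAt c 0 :=
  HasMFDerivAt.continuousAt h

theorem HasVelocityAt.congr {c c' : ℝ → M} {v : E} (h : HasVelocityAt c v)
    (hc : c' =ᶠ[𝓝 0] c) : HasVelocityAt c' v :=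
  HasMFDerivAt.congr_of_eventuallyEq (I := 𝓘(ℝ, ℝ)) (I' := 𝓘(ℝ, E)) (f := c) h hc

theorem HasVelocityAt.unique {c : ℝ → M} {v w : E} (h : HasVelocityAt c v)
    (h' : HasVelocityAt c w) : v = w := by
  have h1 := hasMFDerivAt_unique h h'
  have h2 := DFunLike.congr_fun h1 (1 : ℝ)
  have e1 : (1 : ℝ →L[ℝ] ℝ).smulRight v (1 : ℝ) = v := by simp
  have e2 : (1 : ℝ →L[ℝ] ℝ).smulRight w (1 : ℝ) = w := by simp
  exact e1.symm.trans (h2.trans e2)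

theorem hasVelocityAt_const (x : M) : HasVelocityAt (fun _ : ℝ => x) (0 : E) :=
  (hasMFDerivAt_const (I := 𝓘(ℝ, ℝ)) (I' := 𝓘(ℝ, E)) x (0 : ℝ)).hasVelocityAt (L := 0) rfl

theorem HasVelocityAt.comp_hasMFDerivAt {c : ℝ → M} {v : E} {f : M → N} {L : E →L[ℝ] E'}
    (h : HasVelocityAt c v) {x : M} (hx : c 0 = x)
    (hf : HasMFDerivAt 𝓘(ℝ, E) 𝓘(ℝ, E') f x L) :
    HasVelocityAt (f ∘ c) (L v) := by
  subst hx
  have h1 := HasMFDerivAt.comp (0 : ℝ) hf h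
  exact h1.hasVelocityAt (L := L.comp ((1 : ℝ →L[ℝ] ℝ).smulRight v)) (by simp)

theorem HasVelocityAt.comp {c : ℝ → M} {v : E} {f : M → N}
    (h : HasVelocityAt c v) {x : M} (hx : c 0 = x)
    (hf : MDifferentiableAt 𝓘(ℝ, E) 𝓘(ℝ, E') f x) :
    HasVelocityAt (f ∘ c) (modelDeriv E E' f x v) :=
  h.comp_hasMFDerivAt hx hf.hasMFDerivAt

theorem HasDerivAt.hasVelocityAt {c : ℝ → E} {v : E} (h : HasDerivAt c v 0) :
    HasVelocityAt c v :=
  h.hasFDerivAt.hasMFDerivAt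

theorem hasVelocityAt_line (y v : E) : HasVelocityAt (fun t : ℝ => y + t • v) v := by
  apply HasDerivAt.hasVelocityAt
  simpa using ((hasDerivAt_id (0 : ℝ)).smul_const v).const_add y

theorem modelDeriv_comp {E'' : Type*} [NormedAddCommGroup E''] [NormedSpace ℝ E'']
    {N' : Type*} [TopologicalSpace N'] [ChartedSpace E'' N'] {f : M → N} {g : N → N'} (x : M)
    (hg : MDifferentiableAt 𝓘(ℝ, E') 𝓘(ℝ, E'') g (f x))
    (hf : MDifferentiableAt 𝓘(ℝ, E) 𝓘(ℝ, E') f x) :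
    modelDeriv E E'' (g ∘ f) x = (modelDeriv E' E'' g (f x)).comp (modelDeriv E E' f x) :=
  mfderiv_comp x hg hf

theorem modelDeriv_congr {f g : M → N} {x : M} (h : f =ᶠ[𝓝 x] g) :
    modelDeriv E E' f x = modelDeriv E E' g x :=
  h.mfderiv_eq

theorem modelDeriv_id (x : M) : modelDeriv E E (id : M → M) x = ContinuousLinearMap.id ℝ E :=
  mfderiv_id

theorem modelDeriv_leftInverse_apply {f : M → N} {r : N → M} {x : M}
    (hr : MDifferentiableAt 𝓘(ℝ, E') 𝓘(ℝ, E) r (f x))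
    (hf : MDifferentiableAt 𝓘(ℝ, E) 𝓘(ℝ, E') f x) (h : ∀ᶠ y in 𝓝 x, r (f y) = y) (v : E) :
    modelDeriv E' E r (f x) (modelDeriv E E' f x v) = v := by
  have h1 := modelDeriv_comp x hr hf
  have h2 : modelDeriv E E (r ∘ f) x = modelDeriv E E id x := modelDeriv_congr h
  rw [h2, modelDeriv_id] at h1
  exact (DFunLike.congr_fun h1 v).symm

/-- A curve that is a straight line in a chart of the maximal atlas. -/
theorem hasVelocityAt_chart_symm_line [IsManifold 𝓘(ℝ, E) ∞ M]
    {φ : OpenPartialHomeomorph M E} (hφ : φ ∈ IsManifold.maximalAtlas 𝓘(ℝ, E) ∞ M)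
    {x : M} (hx : x ∈ φ.source) (v : E) :
    HasVelocityAt (fun t : ℝ => φ.symm (φ x + t • modelDeriv E E φ x v)) v := by
  have hφx : MDifferentiableAt 𝓘(ℝ, E) 𝓘(ℝ, E) φ x :=
    (contMDiffAt_of_mem_maximalAtlas hφ hx).mdifferentiableAt (by simp)
  have hφs : MDifferentiableAt 𝓘(ℝ, E) 𝓘(ℝ, E) φ.symm (φ x) :=
    ((contMDiffOn_symm_of_mem_maximalAtlas hφ).contMDiffAt
      (φ.open_target.mem_nhds (φ.map_source hx))).mdifferentiableAt (by simp)
  have h1 := (hasVelocityAt_line (φ x) (modelDeriv E E φ x v)).comp (x := φ x) (by simp) hφs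
  rwa [modelDeriv_leftInverse_apply hφs hφx
    (φ.eventually_left_inverse hx)] at h1

/-- Tangent vectors are realised by curves, so differentials can be computed by following curves. -/
theorem exists_hasVelocityAt [IsManifold 𝓘(ℝ, E) ∞ M] (x : M) (v : E) :
    ∃ c : ℝ → M, c 0 = x ∧ HasVelocityAt c v := by
  have h := hasVelocityAt_chart_symm_line
    (IsManifold.chart_mem_maximalAtlas (I := 𝓘(ℝ, E)) (n := ∞) x) (mem_chart_source E x) v
  refine ⟨_, ?_, h⟩
  simp

end Velocity

/-! ### Submersions: fibres and local sections. -/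

section Submersion

variable {E : Type*} [NormedAddCommGroup E] [NormedSpace ℝ E]
  {M : Type*} [TopologicalSpace M] [ChartedSpace E M]
  {E' : Type*} [NormedAddCommGroup E'] [NormedSpace ℝ E']
  {N : Type*} [TopologicalSpace N] [ChartedSpace E' N]

theorem Manifold.IsSubmersionAt.writtenInCharts' {f : M → N} {x : M}
    (h : IsSubmersionAt 𝓘(ℝ, E) 𝓘(ℝ, E') ∞ f x) {y : E} (hy : y ∈ h.domChart.target) :
    h.codChart (f (h.domChart.symm y)) = (h.equiv y).1 := by
  have hy' : y ∈ (h.domChart.extend 𝓘(ℝ, E)).target := by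
    simpa [OpenPartialHomeomorph.extend_target] using hy
  have := h.writtenInCharts hy'
  simpa using this

/-- A vector in the kernel of the differential of a submersion is tangent to the fibre. -/
theorem Manifold.IsSubmersionAt.exists_hasVelocityAt_fibre
    [IsManifold 𝓘(ℝ, E) ∞ M] [IsManifold 𝓘(ℝ, E') ∞ N] {f : M → N} {x : M}
    (h : IsSubmersionAt 𝓘(ℝ, E) 𝓘(ℝ, E') ∞ f x) {v : E}
    (hv : modelDeriv E E' f x v = 0) :
    ∃ c : ℝ → M, c 0 = x ∧ HasVelocityAt c v ∧ ∀ᶠ t in 𝓝 0, f (c t) = f x := by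
  set φ := h.domChart with hφ
  set ψ := h.codChart with hψ
  have hx : x ∈ φ.source := h.mem_domChart_source
  set w : E := modelDeriv E E φ x v with hw
  have hc := hasVelocityAt_chart_symm_line h.domChart_mem_maximalAtlas hx v
  have hc0 : φ.symm (φ x + (0 : ℝ) • w) = x := by simp [φ.left_inv hx]
  have hmem : ∀ᶠ t : ℝ in 𝓝 0, φ x + t • w ∈ φ.target := by
    have hcont : ContinuousAt (fun t : ℝ => φ x + t • w) 0 := by fun_prop
    exact hcont (φ.open_target.mem_nhds (by simpa using φ.map_source hx))
  have hfψ : ∀ᶠ t : ℝ in 𝓝 0, ψ (f (φ.symm (φ x + t • w))) = (h.equiv (φ x + t • w)).1 := by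
    filter_upwards [hmem] with t ht using h.writtenInCharts' ht
  have hfx : MDifferentiableAt 𝓘(ℝ, E) 𝓘(ℝ, E') f x :=
    h.contMDiffAt.mdifferentiableAt (by simp)
  have hψx : MDifferentiableAt 𝓘(ℝ, E') 𝓘(ℝ, E') ψ (f x) :=
    (contMDiffAt_of_mem_maximalAtlas h.codChart_mem_maximalAtlas
      h.mem_codChart_source).mdifferentiableAt (by simp)
  have h1 := (hc.comp hc0 hfx).comp (f := ψ) (x := f x) (congrArg f hc0) hψx
  have h2 : HasVelocityAt (fun t : ℝ => (h.equiv (φ x + t • w)).1) (h.equiv w).1 := by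
    have := hasVelocityAt_line (h.equiv (φ x)).1 (h.equiv w).1
    simpa using this
  have h3 := (h1.congr (c' := fun t : ℝ => (h.equiv (φ x + t • w)).1)
    (hfψ.mono fun t ht => ht.symm)).unique h2
  -- In the charts the submersion is the first projection of `h.equiv`, so a kernel vector has
  -- vanishing first component and the straight line in its direction never leaves the fibre.
  have h4 : (h.equiv w).1 = 0 := by
    rw [← h3, hv, map_zero]
  refine ⟨_, hc0, hc, ?_⟩
  filter_upwards [hfψ, hmem] with t ht ht'
  have e1 : ψ (f (φ.symm (φ x + t • w))) = ψ (f x) := by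
    rw [ht]
    have := h.writtenInCharts' (φ.map_source hx)
    rw [φ.left_inv hx] at this
    rw [this]
    simp [h4]
  exact ψ.injOn (h.source_subset_preimage_source (φ.map_target ht'))
    h.mem_codChart_source e1

/-- A submersion has smooth local sections through every point. -/
theorem Manifold.IsSubmersionAt.exists_local_section
    [IsManifold 𝓘(ℝ, E) ∞ M] [IsManifold 𝓘(ℝ, E') ∞ N] {f : M → N} {x : M}
    (h : IsSubmersionAt 𝓘(ℝ, E) 𝓘(ℝ, E') ∞ f x) :
    ∃ (s : N → M) (U : Set N), IsOpen U ∧ f x ∈ U ∧ s (f x) = x ∧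
      ContMDiffOn 𝓘(ℝ, E') 𝓘(ℝ, E) ∞ s U ∧ ∀ y ∈ U, f (s y) = y := by
  set φ := h.domChart with hφ
  set ψ := h.codChart with hψ
  have hx : x ∈ φ.source := h.mem_domChart_source
  -- The section in charts: the fibre coordinate is frozen at its value at `x`.
  let k : E' → E := fun z => h.equiv.symm (z, (h.equiv (φ x)).2)
  have hk : ContDiff ℝ ∞ k := by
    have : ContDiff ℝ ∞ (fun z : E' => (z, (h.equiv (φ x)).2)) := contDiff_id.prodMk contDiff_const
    exact h.equiv.symm.contDiff.comp this
  have hkx : k (ψ (f x)) = φ x := by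
    have := h.writtenInCharts' (φ.map_source hx)
    rw [φ.left_inv hx] at this
    simp only [k]
    rw [this]
    simp
  have hopen : IsOpen (ψ.source ∩ ψ ⁻¹' (k ⁻¹' φ.target)) :=
    ψ.isOpen_inter_preimage (φ.open_target.preimage hk.continuous)
  refine ⟨fun y => φ.symm (k (ψ y)), ψ.source ∩ ψ ⁻¹' (k ⁻¹' φ.target), hopen,
    ⟨h.mem_codChart_source, ?_⟩, ?_, ?_, ?_⟩
  · change k (ψ (f x)) ∈ φ.target
    rw [hkx]
    exact φ.map_source hx
  · change φ.symm (k (ψ (f x))) = x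
    rw [hkx, φ.left_inv hx]
  · have h1 : ContMDiffOn 𝓘(ℝ, E') 𝓘(ℝ, E) ∞ (k ∘ ψ) ψ.source :=
      hk.contMDiff.comp_contMDiffOn (contMDiffOn_of_mem_maximalAtlas h.codChart_mem_maximalAtlas)
    exact (contMDiffOn_symm_of_mem_maximalAtlas h.domChart_mem_maximalAtlas).comp
      (h1.mono inter_subset_left) fun y hy => hy.2
  · rintro y ⟨hy, hy'⟩
    have hy'' : k (ψ y) ∈ φ.target := hy'
    refine ψ.injOn (h.source_subset_preimage_source (φ.map_target hy'')) hy ?_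
    rw [h.writtenInCharts' hy'']
    simp [k]

theorem Manifold.IsSubmersionAt.modelDeriv_surjective
    [IsManifold 𝓘(ℝ, E) ∞ M] [IsManifold 𝓘(ℝ, E') ∞ N] {f : M → N} {x : M}
    (h : IsSubmersionAt 𝓘(ℝ, E) 𝓘(ℝ, E') ∞ f x) (w : E') :
    ∃ v : E, modelDeriv E E' f x v = w := by
  obtain ⟨s, U, hU, hxU, hsx, hs, hfs⟩ := h.exists_local_section
  have hs' : MDifferentiableAt 𝓘(ℝ, E') 𝓘(ℝ, E) s (f x) :=
    (hs.contMDiffAt (hU.mem_nhds hxU)).mdifferentiableAt (by simp)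
  have hfx : MDifferentiableAt 𝓘(ℝ, E) 𝓘(ℝ, E') f (s (f x)) := by
    rw [hsx]
    exact h.contMDiffAt.mdifferentiableAt (by simp)
  have h1 := modelDeriv_leftInverse_apply hfx hs'
    (Filter.eventually_of_mem (hU.mem_nhds hxU) hfs) w
  rw [hsx] at h1
  exact ⟨_, h1⟩

end Submersion

/-! ### Immersions: local retractions and differentiability of curves. -/

section Immersion

variable {E : Type*} [NormedAddCommGroup E] [NormedSpace ℝ E]
  {M : Type*} [TopologicalSpace M] [ChartedSpace E M]
  {E' : Type*} [NormedAddCommGroup E'] [NormedSpace ℝ E']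
  {N : Type*} [TopologicalSpace N] [ChartedSpace E' N]

/-- An immersion has a smooth local left inverse. -/
theorem Manifold.IsImmersionAt.exists_local_retraction
    [IsManifold 𝓘(ℝ, E) ∞ M] [IsManifold 𝓘(ℝ, E') ∞ N] {f : M → N} {x : M}
    (h : IsImmersionAt 𝓘(ℝ, E) 𝓘(ℝ, E') ∞ f x) :
    ∃ r : N → M, ContMDiffAt 𝓘(ℝ, E') 𝓘(ℝ, E) ∞ r (f x) ∧ ∀ᶠ y in 𝓝 x, r (f y) = y := by
  set φ := h.domChart with hφ
  set ψ := h.codChart with hψ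
  have hx : x ∈ φ.source := h.mem_domChart_source
  have hwr : ∀ y ∈ φ.source, (h.equiv.symm (ψ (f y))).1 = φ y := by
    intro y hy
    have hy' : φ y ∈ (φ.extend 𝓘(ℝ, E)).target := by
      simpa [OpenPartialHomeomorph.extend_target] using φ.map_source hy
    have := h.writtenInCharts hy'
    have h2 : ψ (f (φ.symm (φ y))) = h.equiv (φ y, 0) := by simpa using this
    rw [φ.left_inv hy] at h2
    rw [h2]
    simp
  -- In the charts the immersion is `y ↦ (y, 0)`; the retraction forgets the second coordinate.
  refine ⟨fun z => φ.symm (h.equiv.symm (ψ z)).1, ?_, ?_⟩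
  · have h1 : ContMDiffAt 𝓘(ℝ, E') 𝓘(ℝ, E') ∞ ψ (f x) :=
      contMDiffAt_of_mem_maximalAtlas h.codChart_mem_maximalAtlas h.mem_codChart_source
    have h2 : ContDiff ℝ ∞ (fun z : E' => (h.equiv.symm z).1) :=
      contDiff_fst.comp h.equiv.symm.contDiff
    have h3 : ContMDiffAt 𝓘(ℝ, E) 𝓘(ℝ, E) ∞ φ.symm ((h.equiv.symm (ψ (f x))).1) := by
      rw [hwr x hx]
      exact (contMDiffOn_symm_of_mem_maximalAtlas h.domChart_mem_maximalAtlas).contMDiffAt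
        (φ.open_target.mem_nhds (φ.map_source hx))
    exact h3.comp (f x) (h2.contMDiff.contMDiffAt.comp (f x) h1)
  · filter_upwards [φ.open_source.mem_nhds hx] with y hy
    rw [hwr y hy, φ.left_inv hy]

theorem Manifold.IsImmersionAt.modelDeriv_injective
    [IsManifold 𝓘(ℝ, E) ∞ M] [IsManifold 𝓘(ℝ, E') ∞ N] {f : M → N} {x : M}
    (h : IsImmersionAt 𝓘(ℝ, E) 𝓘(ℝ, E') ∞ f x) {u v : E}
    (huv : modelDeriv E E' f x u = modelDeriv E E' f x v) :
    u = v := by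
  obtain ⟨r, hr, hrf⟩ := h.exists_local_retraction
  have hr' := hr.mdifferentiableAt (by simp)
  have hfx : MDifferentiableAt 𝓘(ℝ, E) 𝓘(ℝ, E') f x :=
    h.contMDiffAt.mdifferentiableAt (by simp)
  have key := modelDeriv_leftInverse_apply hr' hfx hrf
  rw [← key u, ← key v, huv]

/-- A continuous curve is differentiable if its image under an immersion is. -/
theorem Manifold.IsImmersionAt.exists_hasVelocityAt_of_comp
    [IsManifold 𝓘(ℝ, E) ∞ M] [IsManifold 𝓘(ℝ, E') ∞ N] {f : M → N} {x : M}
    (h : IsImmersionAt 𝓘(ℝ, E) 𝓘(ℝ, E') ∞ f x) {c : ℝ → M} (hc0 : c 0 = x)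
    (hc : ContinuousAt c 0) {w : E'} (hw : HasVelocityAt (f ∘ c) w) :
    ∃ v : E, HasVelocityAt c v ∧ modelDeriv E E' f x v = w := by
  obtain ⟨r, hr, hrf⟩ := h.exists_local_retraction
  have h1 := hw.comp (f := r) (x := f x) (by simp [hc0]) (hr.mdifferentiableAt (by simp))
  have hfx : MDifferentiableAt 𝓘(ℝ, E) 𝓘(ℝ, E') f x :=
    h.contMDiffAt.mdifferentiableAt (by simp)
  have h2 : HasVelocityAt c (modelDeriv E' E r (f x) w) := by
    refine h1.congr ?_
    have : ∀ᶠ t in 𝓝 0, r (f (c t)) = c t := hc (by rw [hc0]; exact hrf)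
    filter_upwards [this] with t ht using ht.symm
  exact ⟨_, h2, (h2.comp hc0 hfx).unique hw⟩

end Immersion

/-! ### Inverse and implicit function theorems on manifolds. -/

section InverseFunction

variable {E : Type*} [NormedAddCommGroup E] [NormedSpace ℝ E]
  {M : Type*} [TopologicalSpace M] [ChartedSpace E M]
  {E' : Type*} [NormedAddCommGroup E'] [NormedSpace ℝ E']
  {N : Type*} [TopologicalSpace N] [ChartedSpace E' N]

/-- The inverse function theorem for maps of manifolds. -/
theorem isLocalDiffeomorphAt_of_modelDeriv_eq [CompleteSpace E] [IsManifold 𝓘(ℝ, E) ∞ M]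
    [IsManifold 𝓘(ℝ, E') ∞ N] {f : M → N} {U : Set M} (hU : IsOpen U)
    (hf : ContMDiffOn 𝓘(ℝ, E) 𝓘(ℝ, E') ∞ f U) {x : M} (hx : x ∈ U) (A : E ≃L[ℝ] E')
    (hA : modelDeriv E E' f x = A) :
    IsLocalDiffeomorphAt 𝓘(ℝ, E) 𝓘(ℝ, E') ∞ f x := by
  set φ := chartAt E x with hφ
  set ψ := chartAt E' (f x) with hψ
  have hφm : φ ∈ IsManifold.maximalAtlas 𝓘(ℝ, E) ∞ M := IsManifold.chart_mem_maximalAtlas x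
  have hψm : ψ ∈ IsManifold.maximalAtlas 𝓘(ℝ, E') ∞ N := IsManifold.chart_mem_maximalAtlas (f x)
  have hxφ : x ∈ φ.source := mem_chart_source E x
  have hxψ : f x ∈ ψ.source := mem_chart_source E' (f x)
  let U' : Set M := U ∩ f ⁻¹' ψ.source
  have hU' : IsOpen U' := hf.continuousOn.isOpen_inter_preimage hU ψ.open_source
  let V : Set E := φ.target ∩ φ.symm ⁻¹' U'
  have hV : IsOpen V := φ.isOpen_inter_preimage_symm hU'
  let g : E → E' := fun y => ψ (f (φ.symm y))
  have hg : ContDiffOn ℝ ∞ g V := by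
    rw [← contMDiffOn_iff_contDiffOn]
    have h1 : ContMDiffOn 𝓘(ℝ, E) 𝓘(ℝ, E) ∞ φ.symm V :=
      (contMDiffOn_symm_of_mem_maximalAtlas hφm).mono inter_subset_left
    exact (contMDiffOn_of_mem_maximalAtlas hψm).comp (hf.comp h1 fun y hy => hy.2.1)
      fun y hy => hy.2.2
  have hxV : φ x ∈ V := by
    refine ⟨φ.map_source hxφ, ?_⟩
    simp only [mem_preimage, φ.left_inv hxφ]
    exact ⟨hx, hxψ⟩
  have hgd : HasFDerivAt g (A : E →L[ℝ] E') (φ x) := by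
    have h1 : HasMFDerivAt 𝓘(ℝ, E) 𝓘(ℝ, E') f x (modelDeriv E E' f x) :=
      ((hf.contMDiffAt (hU.mem_nhds hx)).mdifferentiableAt (by simp)).hasMFDerivAt
    rw [hA] at h1
    have h2 := h1.2
    rw [show range 𝓘(ℝ, E) = univ by simp] at h2
    exact hasFDerivWithinAt_univ.1 h2
  have hgx : ContDiffAt ℝ ∞ g (φ x) := hg.contDiffAt (hV.mem_nhds hxV)
  let R : OpenPartialHomeomorph E E' := hgx.toOpenPartialHomeomorph g hgd (by simp)
  have hRg : ∀ y, R y = g y := fun y => rfl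
  -- Smoothness of the local inverse at a point requires an invertible derivative at its preimage.
  -- Invertibility is an open condition, so the chart expression is restricted to the set where it
  -- holds.
  let W : Set E := V ∩ fderiv ℝ g ⁻¹' range ((↑) : (E ≃L[ℝ] E') → E →L[ℝ] E')
  have hW : IsOpen W :=
    (hg.continuousOn_fderiv_of_isOpen hV (by simp)).isOpen_inter_preimage hV
      ContinuousLinearEquiv.isOpen
  have hxW : φ x ∈ W := ⟨hxV, A, hgd.fderiv.symm⟩
  let R' : OpenPartialHomeomorph E E' := R.restrOpen W hW
  have hR'W : ∀ y ∈ R'.source, y ∈ W := fun y hy => by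
    simp only [R', OpenPartialHomeomorph.restrOpen_source] at hy
    exact hy.2
  have hR'x : φ x ∈ R'.source := by
    simp only [R', OpenPartialHomeomorph.restrOpen_source]
    exact ⟨hgx.mem_toOpenPartialHomeomorph_source hgd (by simp), hxW⟩
  have hR'g : ∀ y, R' y = g y := fun y => rfl
  have hR'symm : ContDiffOn ℝ ∞ R'.symm R'.target := by
    intro z hz
    have hy := hR'W _ (R'.map_target hz)
    obtain ⟨B, hB⟩ := hy.2
    have hgy : ContDiffAt ℝ ∞ g (R'.symm z) := hg.contDiffAt (hV.mem_nhds hy.1)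
    have hd : HasFDerivAt g (B : E →L[ℝ] E') (R'.symm z) := by
      rw [hB]
      exact (hgy.differentiableAt (by simp)).hasFDerivAt
    exact (R'.contDiffAt_symm hz hd hgy).contDiffWithinAt
  let T : OpenPartialHomeomorph M N := (φ.trans R').trans ψ.symm
  have hTf : EqOn f T T.source := by
    intro y hy
    simp only [T, OpenPartialHomeomorph.trans_source, mem_inter_iff, mem_preimage] at hy
    have hW' := hR'W _ hy.1.2
    have h1 : f y ∈ ψ.source := by
      have := hW'.1.2.2
      simpa [φ.left_inv hy.1.1] using this
    simp [T, hR'g, g, φ.left_inv hy.1.1, ψ.left_inv h1]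
  have hTU : T.source ⊆ U := by
    intro y hy
    simp only [T, OpenPartialHomeomorph.trans_source, mem_inter_iff, mem_preimage] at hy
    have := (hR'W _ hy.1.2).1.2.1
    simpa [φ.left_inv hy.1.1] using this
  refine ⟨{ toPartialEquiv := T.toPartialEquiv
            open_source := T.open_source
            open_target := T.open_target
            contMDiffOn_toFun := (hf.mono hTU).congr fun y hy => (hTf hy).symm
            contMDiffOn_invFun := ?_ }, ?_, hTf⟩
  · have h1 : ContMDiffOn 𝓘(ℝ, E') 𝓘(ℝ, E') ∞ ψ T.target := by
      refine (contMDiffOn_of_mem_maximalAtlas hψm).mono fun z hz => ?_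
      simp only [T, OpenPartialHomeomorph.trans_target, mem_inter_iff] at hz
      simpa using hz.1
    have h2 := (contMDiffOn_iff_contDiffOn.2 hR'symm).comp h1 (fun z hz => by
      simp only [T, OpenPartialHomeomorph.trans_target, mem_inter_iff, mem_preimage] at hz
      simpa using hz.2.1)
    exact (contMDiffOn_symm_of_mem_maximalAtlas hφm).comp h2 (fun z hz => by
      simp only [T, OpenPartialHomeomorph.trans_target, mem_inter_iff, mem_preimage] at hz
      simpa using hz.2.2)
  · change x ∈ T.source
    simp only [T, OpenPartialHomeomorph.trans_source, mem_inter_iff, mem_preimage]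
    refine ⟨⟨hxφ, hR'x⟩, ?_⟩
    simp [hR'g, g, φ.left_inv hxφ, ψ.map_source hxψ]

/-- A continuous curve is differentiable if its image under a smooth map with injective
differential is. -/
theorem exists_hasVelocityAt_of_comp_of_injective [FiniteDimensional ℝ E]
    [FiniteDimensional ℝ E'] [IsManifold 𝓘(ℝ, E) ∞ M] [IsManifold 𝓘(ℝ, E') ∞ N] {f : M → N}
    (hf : ContMDiff 𝓘(ℝ, E) 𝓘(ℝ, E') ∞ f) {x : M}
    (hinj : ∀ v : E, modelDeriv E E' f x v = 0 → v = 0) {c : ℝ → M} (hc0 : c 0 = x)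
    (hc : ContinuousAt c 0) {w : E'} (hw : HasVelocityAt (f ∘ c) w) :
    ∃ v : E, HasVelocityAt c v ∧ modelDeriv E E' f x v = w := by
  have : CompleteSpace E := FiniteDimensional.complete ℝ E
  set ψ := chartAt E' (f x) with hψ
  have hψm : ψ ∈ IsManifold.maximalAtlas 𝓘(ℝ, E') ∞ N := IsManifold.chart_mem_maximalAtlas (f x)
  have hxψ : f x ∈ ψ.source := mem_chart_source E' (f x)
  have hψx : MDifferentiableAt 𝓘(ℝ, E') 𝓘(ℝ, E') ψ (f x) :=
    (contMDiffAt_of_mem_maximalAtlas hψm hxψ).mdifferentiableAt (by simp)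
  have hψs : MDifferentiableAt 𝓘(ℝ, E') 𝓘(ℝ, E') ψ.symm (ψ (f x)) :=
    ((contMDiffOn_symm_of_mem_maximalAtlas hψm).contMDiffAt
      (ψ.open_target.mem_nhds (ψ.map_source hxψ))).mdifferentiableAt (by simp)
  have hfx : MDifferentiableAt 𝓘(ℝ, E) 𝓘(ℝ, E') f x :=
    hf.contMDiffAt.mdifferentiableAt (by simp)
  let B : E →L[ℝ] E' := (modelDeriv E' E' ψ (f x)).comp (modelDeriv E E' f x)
  have hB : LinearMap.ker (B : E →ₗ[ℝ] E') = ⊥ := by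
    rw [LinearMap.ker_eq_bot']
    intro v hv
    refine hinj v ?_
    have := modelDeriv_leftInverse_apply hψs hψx (ψ.eventually_left_inverse hxψ)
      (modelDeriv E E' f x v)
    rw [← this, show modelDeriv E' E' ψ (f x) (modelDeriv E E' f x v) = 0 from hv, map_zero]
  -- A linear left inverse `L` of the differential in the chart makes `L ∘ ψ ∘ f` have identity
  -- differential at `x`. It is therefore a local diffeomorphism, and `c` is recovered from `f ∘ c`
  -- by a differentiable map.
  obtain ⟨L₀, hL₀⟩ := LinearMap.exists_leftInverse_of_injective (B : E →ₗ[ℝ] E') hB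
  let L : E' →L[ℝ] E := L₀.toContinuousLinearMap
  have hL : ∀ v, L (B v) = v := fun v => LinearMap.congr_fun hL₀ v
  have hLs : ContMDiff 𝓘(ℝ, E') 𝓘(ℝ, E) ∞ L := L.contDiff.contMDiff
  have hLψ : MDifferentiableAt 𝓘(ℝ, E') 𝓘(ℝ, E) (L ∘ ψ) (f x) :=
    (hLs.contMDiffAt.mdifferentiableAt (by simp)).comp (f x) hψx
  let U : Set M := f ⁻¹' ψ.source
  have hU : IsOpen U := ψ.open_source.preimage hf.continuous
  have hh : ContMDiffOn 𝓘(ℝ, E) 𝓘(ℝ, E) ∞ ((L ∘ ψ) ∘ f) U :=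
    (hLs.comp_contMDiffOn (contMDiffOn_of_mem_maximalAtlas hψm)).comp hf.contMDiffOn
      fun y hy => hy
  have hLd : modelDeriv E' E L (ψ (f x)) = L := L.hasMFDerivAt.mfderiv
  have hderiv : modelDeriv E E ((L ∘ ψ) ∘ f) x = (ContinuousLinearEquiv.refl ℝ E : E →L[ℝ] E) := by
    rw [modelDeriv_comp x hLψ hfx,
      modelDeriv_comp (f x) (hLs.contMDiffAt.mdifferentiableAt (by simp)) hψx, hLd]
    ext v
    exact hL v
  obtain ⟨Φ, hxΦ, hΦ⟩ := isLocalDiffeomorphAt_of_modelDeriv_eq hU hh (x := x) hxψ _ hderiv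
  have hw1 := hw.comp (f := L ∘ ψ) (x := f x) (congrArg f hc0) hLψ
  have hΦx : Φ.toPartialEquiv x = L (ψ (f x)) := (hΦ hxΦ).symm
  have hΦs : MDifferentiableAt 𝓘(ℝ, E) 𝓘(ℝ, E) Φ.toPartialEquiv.symm (L (ψ (f x))) := by
    rw [← hΦx]
    exact (Φ.contMDiffOn_invFun.contMDiffAt
      (Φ.open_target.mem_nhds (Φ.map_source hxΦ))).mdifferentiableAt (by simp)
  have hw2 := hw1.comp (f := Φ.toPartialEquiv.symm) (x := L (ψ (f x))) (by simp [hc0]) hΦs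
  have hcv : HasVelocityAt c _ := hw2.congr (c' := c) (by
    have : ∀ᶠ t in 𝓝 0, c t ∈ Φ.source := hc (Φ.open_source.mem_nhds (by rwa [hc0]))
    filter_upwards [this] with t ht
    have h1 : L (ψ (f (c t))) = Φ.toPartialEquiv (c t) := hΦ ht
    simp only [Function.comp_apply]
    rw [h1, Φ.left_inv ht])
  exact ⟨_, hcv, (hcv.comp hc0 hfx).unique hw⟩

/-- A vector in the kernel of the differential of a smooth map at a regular point is tangent to the
level set. -/
theorem exists_hasVelocityAt_level [FiniteDimensional ℝ E]
    [FiniteDimensional ℝ E'] [IsManifold 𝓘(ℝ, E) ∞ M] {f : M → E'}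
    (hf : ContMDiff 𝓘(ℝ, E) 𝓘(ℝ, E') ∞ f) {x : M}
    (hsurj : ∀ z : E', ∃ v : E, modelDeriv E E' f x v = z) {w : E}
    (hw : modelDeriv E E' f x w = 0) :
    ∃ c : ℝ → M, c 0 = x ∧ HasVelocityAt c w ∧ ∀ᶠ t in 𝓝 0, f (c t) = f x := by
  have : CompleteSpace E := FiniteDimensional.complete ℝ E
  set φ := chartAt E x with hφ
  have hφm : φ ∈ IsManifold.maximalAtlas 𝓘(ℝ, E) ∞ M := IsManifold.chart_mem_maximalAtlas x
  have hxφ : x ∈ φ.source := mem_chart_source E x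
  have hφx : MDifferentiableAt 𝓘(ℝ, E) 𝓘(ℝ, E) φ x :=
    (contMDiffAt_of_mem_maximalAtlas hφm hxφ).mdifferentiableAt (by simp)
  have hφsm : ContMDiffAt 𝓘(ℝ, E) 𝓘(ℝ, E) ∞ φ.symm (φ x) :=
    (contMDiffOn_symm_of_mem_maximalAtlas hφm).contMDiffAt
      (φ.open_target.mem_nhds (φ.map_source hxφ))
  have hφs : MDifferentiableAt 𝓘(ℝ, E) 𝓘(ℝ, E) φ.symm (φ x) := hφsm.mdifferentiableAt (by simp)
  have hdφ := modelDeriv_leftInverse_apply hφs hφx (φ.eventually_left_inverse hxφ)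
  let g : E → E' := f ∘ φ.symm
  have hg : ContDiffAt ℝ ∞ g (φ x) := (hf.contMDiffAt.comp (φ x) hφsm).contDiffAt
  have hg' := hg.hasStrictFDerivAt (n := ∞) (by simp)
  have hfx : MDifferentiableAt 𝓘(ℝ, E) 𝓘(ℝ, E') f (φ.symm (φ x)) :=
    hf.contMDiffAt.mdifferentiableAt (by simp)
  have hgf : ∀ v, fderiv ℝ g (φ x) (modelDeriv E E φ x v) = modelDeriv E E' f x v := by
    intro v
    have h1 := modelDeriv_comp (φ x) hfx hφs
    have h2 : modelDeriv E E' (f ∘ φ.symm) (φ x) = fderiv ℝ g (φ x) := mfderiv_eq_fderiv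
    rw [← h2, h1, ContinuousLinearMap.comp_apply, hdφ, φ.left_inv hxφ]
  have hrange : (fderiv ℝ g (φ x)).range = ⊤ := by
    rw [LinearMap.range_eq_top]
    intro z
    obtain ⟨v, hv⟩ := hsurj z
    exact ⟨modelDeriv E E φ x v, (hgf v).trans hv⟩
  -- The implicit function parametrises the level set by the kernel of the derivative and has the
  -- inclusion as its derivative at `0`; the line through `k` thus gives a curve in the level set
  -- with the required velocity.
  let k : (fderiv ℝ g (φ x)).ker := ⟨modelDeriv E E φ x w, (hgf w).trans hw⟩
  let I := hg'.implicitFunction g _ hrange (g (φ x))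
  have hI : HasStrictFDerivAt I (fderiv ℝ g (φ x)).ker.subtypeL 0 :=
    hg'.to_implicitFunction hrange
  have hI0 : I 0 = φ x := by
    exact hg'.implicitFunction_apply_image hrange
  have hIg : ∀ᶠ p in 𝓝 (0 : (fderiv ℝ g (φ x)).ker), g (I p) = g (φ x) := by
    have h1 := hg'.map_implicitFunction_eq hrange
    have h2 : Tendsto (fun p : (fderiv ℝ g (φ x)).ker => (g (φ x), p)) (𝓝 0)
        (𝓝 (g (φ x), 0)) := by
      have : Continuous (fun p : (fderiv ℝ g (φ x)).ker => (g (φ x), p)) := by fun_prop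
      exact this.tendsto 0
    exact h2.eventually h1
  have hl : HasDerivAt (fun t : ℝ => t • k) k 0 := by
    simpa using (hasDerivAt_id (0 : ℝ)).smul_const k
  have hIl : HasDerivAt (fun t : ℝ => I (t • k)) (modelDeriv E E φ x w) 0 := by
    have h1 : HasFDerivAt I (fderiv ℝ g (φ x)).ker.subtypeL ((0 : ℝ) • k) := by
      rw [zero_smul]; exact hI.hasFDerivAt
    exact h1.comp_hasDerivAt (0 : ℝ) hl
  have hv := hIl.hasVelocityAt.comp (f := φ.symm) (x := φ x) (by simp [hI0]) hφs
  rw [hdφ] at hv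
  refine ⟨_, by simp [hI0, φ.left_inv hxφ], hv, ?_⟩
  have h3 : Tendsto (fun t : ℝ => t • k) (𝓝 0) (𝓝 0) := by
    have := hl.continuousAt.tendsto
    simpa using this
  filter_upwards [h3.eventually hIg] with t ht
  have : f (φ.symm (I (t • k))) = f (φ.symm (φ x)) := ht
  rwa [φ.left_inv hxφ] at this

end InverseFunction

/-! ### Linear algebra of alternating forms. -/

section LinearAlgebra

variable {E : Type*} [NormedAddCommGroup E] [NormedSpace ℝ E]

theorem update_pair {E : Type*} (u v w : E) : Function.update ![u, v] 1 w = ![u, w] := by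
  ext i
  fin_cases i <;> rfl

/-- The bilinear pairing given by an alternating 2-form. -/
def pairing (B : E [⋀^Fin 2]→L[ℝ] ℝ) : E →ₗ[ℝ] E →ₗ[ℝ] ℝ :=
  LinearMap.mk₂ ℝ (fun u v => B ![u, v])
    (fun u u' v => B.vecCons_add ![v] u u')
    (fun a u v => B.vecCons_smul ![v] a u)
    (fun u v v' => by
      have := B.map_update_add ![u, v] 1 v v'
      rwa [update_pair, update_pair, update_pair] at this)
    (fun a u v => by
      have := B.map_update_smul ![u, v] 1 a v
      rwa [update_pair, update_pair] at this)

@[simp]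
theorem pairing_apply (B : E [⋀^Fin 2]→L[ℝ] ℝ) (u v : E) : pairing B u v = B ![u, v] := rfl

/-- The double symplectic complement of a finite-dimensional subspace is that subspace. -/
theorem exists_eq_of_symplectic_complement {g : Type*} [AddCommGroup g] [Module ℝ g]
    {ι : Type*} [Finite ι] (b : Module.Basis ι ℝ g) {B : E [⋀^Fin 2]→L[ℝ] ℝ}
    (hB : ∀ u : E, (∀ v, B ![u, v] = 0) → u = 0) (X : g →ₗ[ℝ] E) {a : E}
    (ha : ∀ v : E, (∀ ξ, B ![X ξ, v] = 0) → B ![a, v] = 0) : ∃ ξ, X ξ = a := by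
  have h1 : pairing B a ∈ Submodule.span ℝ (range fun i => pairing B (X (b i))) := by
    -- A functional vanishing on the common kernel of finitely many functionals is a linear
    -- combination of them.
    refine mem_span_of_iInf_ker_le_ker fun v hv => ?_
    simp only [Submodule.mem_iInf, LinearMap.mem_ker] at hv
    refine ha v fun ξ => ?_
    have : (pairing B).flip v ∘ₗ X = 0 := b.ext fun i => hv i
    exact LinearMap.congr_fun this ξ
  have h2 : Submodule.span ℝ (range fun i => pairing B (X (b i))) ≤
      LinearMap.range (pairing B ∘ₗ X) := by
    rw [Submodule.span_le]
    rintro _ ⟨i, rfl⟩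
    exact ⟨b i, rfl⟩
  obtain ⟨ξ, hξ⟩ := h2 h1
  refine ⟨ξ, ?_⟩
  have h3 : pairing B (X ξ - a) = 0 := by
    rw [map_sub, sub_eq_zero]
    exact hξ
  exact sub_eq_zero.1 (hB _ fun v => LinearMap.congr_fun h3 v)

/-- Linearly independent vectors give independent functionals under a nondegenerate form. -/
theorem exists_pairing_eq {g : Type*} [AddCommGroup g] [Module ℝ g]
    {ι : Type*} [Fintype ι] (b : Module.Basis ι ℝ g) {B : E [⋀^Fin 2]→L[ℝ] ℝ}
    (hB : ∀ u : E, (∀ v, B ![u, v] = 0) → u = 0) (X : g →ₗ[ℝ] E) (hX : ∀ ξ, X ξ = 0 → ξ = 0)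
    (z : ι → ℝ) : ∃ v : E, ∀ i, B ![X (b i), v] = z i := by
  let T : E →ₗ[ℝ] ι → ℝ := LinearMap.pi fun i => pairing B (X (b i))
  suffices h : LinearMap.range T = ⊤ by
    obtain ⟨v, hv⟩ := LinearMap.range_eq_top.1 h z
    exact ⟨v, fun i => congrFun hv i⟩
  by_contra h
  -- A nonzero functional vanishing on a proper range has coefficients that combine the basis into a
  -- `ξ` with `X ξ` paired to zero with everything. Then `X ξ = 0`, so `ξ = 0` and all coefficients
  -- vanish.
  obtain ⟨f, hf, hle⟩ := Submodule.exists_le_ker_of_lt_top _ (lt_top_iff_ne_top.2 h)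
  classical
  let e : ι → ι → ℝ := fun i j => if i = j then 1 else 0
  have hf' : ∀ y, f y = ∑ i, y i * f (e i) := fun y => LinearMap.pi_apply_eq_sum_univ f y
  let ξ : g := ∑ i, f (e i) • b i
  have hξ : X ξ = 0 := by
    refine hB _ fun v => ?_
    have h1 : f (T v) = 0 := hle ⟨v, rfl⟩
    rw [hf'] at h1
    change pairing B (X ξ) v = 0
    rw [← h1]
    simp only [ξ, map_sum, map_smul, LinearMap.sum_apply, LinearMap.smul_apply, smul_eq_mul]
    exact Finset.sum_congr rfl fun i _ => mul_comm _ _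
  have h2 := Fintype.linearIndependent_iff.1 b.linearIndependent _ (hX ξ hξ)
  exact hf (LinearMap.ext fun y => by simp [hf' y, h2])

end LinearAlgebra

/-! ### Evaluating 2-forms on pairs of vectors. -/

section Forms

variable {E : Type*} [NormedAddCommGroup E] [NormedSpace ℝ E]
  {M : Type*} [TopologicalSpace M] [ChartedSpace E M]
  {E' : Type*} [NormedAddCommGroup E'] [NormedSpace ℝ E']
  {N : Type*} [TopologicalSpace N] [ChartedSpace E' N]

/-- A 2-form at a point, on the model space. -/
def TwoForm.at (Ω : TwoForm E M) (x : M) : E [⋀^Fin 2]→L[ℝ] ℝ := Ω x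

theorem alternating_ext_pair {B C : E [⋀^Fin 2]→L[ℝ] ℝ} (h : ∀ u v, B ![u, v] = C ![u, v]) :
    B = C := by
  ext m
  have : m = ![m 0, m 1] := by
    ext i
    fin_cases i <;> rfl
  rw [this]
  exact h _ _

theorem compContinuousLinearMap_pair (B : E' [⋀^Fin 2]→L[ℝ] ℝ) (L : E →L[ℝ] E') (u v : E) :
    B.compContinuousLinearMap L ![u, v] = B ![L u, L v] := by
  rw [ContinuousAlternatingMap.compContinuousLinearMap_apply]
  congr 1
  ext i
  fin_cases i <;> rfl

theorem TwoForm.ext_at {Ω Ω' : TwoForm E M}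
    (h : ∀ x u v, Ω.at x ![u, v] = Ω'.at x ![u, v]) : Ω = Ω' :=
  funext fun x => alternating_ext_pair (B := Ω.at x) (C := Ω'.at x) (h x)

theorem pullbackForm_at (f : M → N) (Ω : TwoForm E' N) (x : M) (u v : E) :
    (pullbackForm (E := E) f Ω).at x ![u, v] =
      Ω.at (f x) ![modelDeriv E E' f x u, modelDeriv E E' f x v] :=
  compContinuousLinearMap_pair (Ω.at (f x)) (modelDeriv E E' f x) u v

theorem alternating_swap (B : E [⋀^Fin 2]→L[ℝ] ℝ) (u v : E) : B ![u, v] = - B ![v, u] := by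
  have h := B.toAlternatingMap.map_swap ![v, u] (i := 0) (j := 1) (by simp)
  have e : ![v, u] ∘ Equiv.swap (0 : Fin 2) 1 = ![u, v] := by
    ext i
    fin_cases i <;> rfl
  rw [e] at h
  exact h

end Forms

/-! ### Free and proper actions. -/

section Actions

variable {E : Type*} [NormedAddCommGroup E] [NormedSpace ℝ E]
  {M : Type*} [TopologicalSpace M] [ChartedSpace E M]
  {EG : Type*} [NormedAddCommGroup EG] [NormedSpace ℝ EG]
  {G : Type*} [TopologicalSpace G] [ChartedSpace EG G] [Group G]
  [MulAction G M]

/-- The infinitesimal action at `x`, as a linear map of the model spaces. -/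
def generatorMap (EG : Type*) [NormedAddCommGroup EG] [NormedSpace ℝ EG]
    (E : Type*) [NormedAddCommGroup E] [NormedSpace ℝ E]
    {M : Type*} [TopologicalSpace M] [ChartedSpace E M]
    (G : Type*) [TopologicalSpace G] [ChartedSpace EG G] [Group G] [MulAction G M] (x : M) :
    EG →L[ℝ] E :=
  modelDeriv EG E (fun g : G => g • x) 1

theorem contMDiff_orbitMap [ContMDiffSMul 𝓘(ℝ, EG) 𝓘(ℝ, E) ∞ G M] (x : M) :
    ContMDiff 𝓘(ℝ, EG) 𝓘(ℝ, E) ∞ (fun g : G => g • x) :=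
  (contMDiff_smul (I := 𝓘(ℝ, EG)) (I' := 𝓘(ℝ, E)) (n := ∞) (G := G) (M := M)).comp
    (contMDiff_id.prodMk contMDiff_const)

theorem contMDiff_smul_left [ContMDiffSMul 𝓘(ℝ, EG) 𝓘(ℝ, E) ∞ G M] (g : G) :
    ContMDiff 𝓘(ℝ, E) 𝓘(ℝ, E) ∞ (fun x : M => g • x) :=
  (contMDiff_smul (I := 𝓘(ℝ, EG)) (I' := 𝓘(ℝ, E)) (n := ∞) (G := G) (M := M)).comp
    (contMDiff_const.prodMk contMDiff_id)

/-- The differential of the orbit map at `g`, along the left invariant vector field of `ξ`. -/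
theorem modelDeriv_orbitMap_leftInvariant [LieGroup 𝓘(ℝ, EG) ∞ G]
    [ContMDiffSMul 𝓘(ℝ, EG) 𝓘(ℝ, E) ∞ G M] (x : M) (g : G) (ξ : EG) :
    modelDeriv EG E (fun g : G => g • x) g (modelDeriv EG EG (g * ·) (1 : G) ξ) =
      modelDeriv E E (fun y : M => g • y) x (generatorMap EG E G x ξ) := by
  have hL : MDifferentiableAt 𝓘(ℝ, EG) 𝓘(ℝ, EG) (g * ·) (1 : G) :=
    (contMDiff_mul_left (I := 𝓘(ℝ, EG)) (n := ∞) (a := g)).contMDiffAt.mdifferentiableAt (by simp)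
  have ho : ∀ k : G, MDifferentiableAt 𝓘(ℝ, EG) 𝓘(ℝ, E) (fun g : G => g • x) k := fun k =>
    (contMDiff_orbitMap x).contMDiffAt.mdifferentiableAt (by simp)
  have hg : MDifferentiableAt 𝓘(ℝ, E) 𝓘(ℝ, E) (fun y : M => g • y) ((1 : G) • x) :=
    (contMDiff_smul_left (EG := EG) g).contMDiffAt.mdifferentiableAt (by simp)
  have h1 := modelDeriv_comp (1 : G) (f := (g * ·)) (ho (g * 1)) hL
  have h2 := modelDeriv_comp (1 : G) (f := fun k : G => k • x) hg (ho 1)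
  have h3 : (fun k : G => k • x) ∘ (g * ·) = (fun y : M => g • y) ∘ fun k : G => k • x := by
    ext k
    simp [mul_smul]
  rw [h3, h2, mul_one, one_smul] at h1
  exact (DFunLike.congr_fun h1 ξ).symm

/-- The infinitesimal action of a free action is injective. -/
theorem generatorMap_injective [FiniteDimensional ℝ EG] [FiniteDimensional ℝ E]
    [T2Space M] [IsManifold 𝓘(ℝ, E) ∞ M] [LieGroup 𝓘(ℝ, EG) ∞ G]
    [ContMDiffSMul 𝓘(ℝ, EG) 𝓘(ℝ, E) ∞ G M] {x : M} (hfree : ∀ g : G, g • x = x → g = 1)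
    {ξ : EG} (hξ : generatorMap EG E G x ξ = 0) : ξ = 0 := by
  have : CompleteSpace E := FiniteDimensional.complete ℝ E
  have : CompleteSpace EG := FiniteDimensional.complete ℝ EG
  have hG : LieGroup 𝓘(ℝ, EG) (minSmoothness ℝ 3) G :=
    LieGroup.of_le (n := ∞) (by
      rw [minSmoothness_of_isRCLikeNormedField]
      exact WithTop.coe_le_coe.2 le_top)
  have : IsManifold 𝓘(ℝ, EG) ∞ G :=
    (inferInstance : ContMDiffMul 𝓘(ℝ, EG) ∞ G).toIsManifold
  have : IsManifold 𝓘(ℝ, EG) 1 G := IsManifold.of_le (n := ∞) (by simp)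
  have : IsManifold 𝓘(ℝ, E) 1 M := IsManifold.of_le (n := ∞) (by simp)
  -- The integral curve `γ` of the left invariant field of `ξ` replaces the exponential. The
  -- velocity of `γ t • x` is the image of the generator at `x` under the differential of `γ t`,
  -- hence zero; so that curve is constant, freeness gives `γ t = 1` near `0`, and its velocity `ξ`
  -- vanishes.
  let V : ∀ g : G, TangentSpace 𝓘(ℝ, EG) g :=
    mulInvariantVectorField (I := 𝓘(ℝ, EG)) (G := G) ξ
  have hV : ContMDiffAt 𝓘(ℝ, EG) 𝓘(ℝ, EG).tangent 1
      (fun g => (⟨g, V g⟩ : TangentBundle 𝓘(ℝ, EG) G)) 1 :=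
    (contMDiffAt_mulInvariantVectorField (I := 𝓘(ℝ, EG)) (G := G) ξ).of_le
      (by simp [minSmoothness_of_isRCLikeNormedField])
  obtain ⟨γ, hγ0, hγ⟩ := exists_isMIntegralCurveAt_of_contMDiffAt_boundaryless (t₀ := 0) hV
  have hc : IsMIntegralCurveAt (fun t => γ t • x) (fun y : M => (0 : TangentSpace 𝓘(ℝ, E) y)) 0 := by
    have hγ' : ∀ᶠ t in 𝓝 (0 : ℝ), HasMFDerivAt 𝓘(ℝ, ℝ) 𝓘(ℝ, EG) γ t
      ((1 : ℝ →L[ℝ] ℝ).smulRight (V (γ t))) := hγ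
    change ∀ᶠ t in 𝓝 (0 : ℝ), HasMFDerivAt 𝓘(ℝ, ℝ) 𝓘(ℝ, E) (fun t => γ t • x) t
      ((1 : ℝ →L[ℝ] ℝ).smulRight (0 : E))
    filter_upwards [hγ'] with t ht
    have ho : HasMFDerivAt 𝓘(ℝ, EG) 𝓘(ℝ, E) (fun g : G => g • x) (γ t)
        (modelDeriv EG E (fun g : G => g • x) (γ t)) :=
      ((contMDiff_orbitMap x).contMDiffAt.mdifferentiableAt (by simp)).hasMFDerivAt
    have h1 := HasMFDerivAt.comp t ho ht
    have e : (1 : ℝ →L[ℝ] ℝ).smulRight (0 : E) = (modelDeriv EG E (fun g : G => g • x) (γ t)).comp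
        ((1 : ℝ →L[ℝ] ℝ).smulRight (modelDeriv EG EG (γ t * ·) (1 : G) ξ)) := by
      ext
      simp [modelDeriv_orbitMap_leftInvariant, hξ]
    exact e ▸ h1
  have hx : IsMIntegralCurveAt (fun _ => x) (fun y : M => (0 : TangentSpace 𝓘(ℝ, E) y)) 0 :=
    (isMIntegralCurve_const rfl).isMIntegralCurveAt 0
  have heq := isMIntegralCurveAt_eventuallyEq_of_contMDiffAt_boundaryless
    (v := fun y : M => (0 : TangentSpace 𝓘(ℝ, E) y)) (t₀ := 0)
    (Bundle.contMDiff_zeroSection ℝ (TangentSpace 𝓘(ℝ, E))).contMDiffAt hc hx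
    (by simp [hγ0])
  have h1 : HasVelocityAt γ ξ := by
    refine hγ.hasMFDerivAt.hasVelocityAt (L := (1 : ℝ →L[ℝ] ℝ).smulRight
      (modelDeriv EG EG (γ 0 * ·) (1 : G) ξ)) ?_
    have : (fun k : G => (1 : G) * k) = id := by ext; simp
    rw [hγ0, this, modelDeriv_id]
    simp
  refine h1.unique ((hasVelocityAt_const (1 : G)).congr ?_)
  filter_upwards [heq] with t ht using hfree _ ht

/-- For a free proper action, `g` depends continuously on `g • x`. -/
theorem isInducing_orbitMap [T2Space M] [ProperSMul G M] {x : M}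
    (hfree : ∀ g : G, g • x = x → g = 1) : Topology.IsInducing (fun g : G => g • x) := by
  have hr : range (fun g : G => (g, x)) = Prod.snd ⁻¹' {x} := by
    ext ⟨g, y⟩
    simp [eq_comm]
  -- Restricting the proper map `(g, y) ↦ (g • y, y)` to the closed slice `y = x` keeps it proper;
  -- freeness makes it injective, hence a closed embedding.
  have hp : IsProperMap (fun g : G => (g • x, x)) :=
    (ProperSMul.isProperMap_smul_pair (G := G) (X := M)).comp
      (f := fun g : G => (g, x)) (Topology.IsClosedEmbedding.isProperMap
        ⟨isEmbedding_prodMkLeft x, hr ▸ isClosed_singleton.preimage continuous_snd⟩)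
  have hinj : Function.Injective (fun g : G => (g • x, x)) := by
    intro g k hgk
    have h1 : g • x = k • x := (Prod.ext_iff.1 hgk).1
    have h2 := hfree (k⁻¹ * g) (by rw [mul_smul, h1, inv_smul_smul])
    rw [inv_mul_eq_one] at h2
    exact h2.symm
  have he := Topology.IsClosedEmbedding.of_continuous_injective_isClosedMap
    hp.continuous hinj hp.isClosedMap
  have h2 : Topology.IsInducing (fun g : G => (g • x, x)) := he.isInducing
  exact Topology.IsInducing.of_comp (continuous_fst.comp hp.continuous)
    (Continuous.prodMk continuous_id continuous_const) h2

end Actions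

/-! ### The level set, its null directions and the reduced form. -/

section Reduced

set_option linter.unusedSectionVars false

variable {E : Type*} [NormedAddCommGroup E] [NormedSpace ℝ E] [FiniteDimensional ℝ E]
  {M : Type*} [TopologicalSpace M] [T2Space M] [ChartedSpace E M] [IsManifold 𝓘(ℝ, E) ∞ M]
  {EG : Type*} [NormedAddCommGroup EG] [NormedSpace ℝ EG] [FiniteDimensional ℝ EG]
  {G : Type*} [TopologicalSpace G] [ChartedSpace EG G] [Group G] [LieGroup 𝓘(ℝ, EG) ∞ G]
  [MulAction G M] [ContMDiffSMul 𝓘(ℝ, EG) 𝓘(ℝ, E) ∞ G M]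
  {Ω : TwoForm E M} {J : M → Module.Dual ℝ (GroupLieAlgebra 𝓘(ℝ, EG) G)}
  {μ : Module.Dual ℝ (GroupLieAlgebra 𝓘(ℝ, EG) G)} {H : M → ℝ}
  {EL : Type*} [NormedAddCommGroup EL] [NormedSpace ℝ EL]
  [ChartedSpace EL (MomentumLevel J μ)]
  {EP : Type*} [NormedAddCommGroup EP] [NormedSpace ℝ EP]
  [ChartedSpace EP (ReducedSpace G J μ)]

theorem IsHamiltonianSystemWithSymmetry.momentum_apply
    (h : IsHamiltonianSystemWithSymmetry Ω J μ H) (x : M) (ξ : EG) (w : E) :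
    Ω.at x ![generatorMap EG E G x ξ, w] = modelDeriv E ℝ (fun y => J y ξ) x w :=
  h.momentum ξ x w

theorem IsHamiltonianSystemWithSymmetry.nondegenerate_at
    (h : IsHamiltonianSystemWithSymmetry Ω J μ H) (x : M) (u : E)
    (hu : ∀ v : E, Ω.at x ![u, v] = 0) : u = 0 :=
  h.symplectic.nondegenerate x u hu

theorem IsHamiltonianSystemWithSymmetry.invariant_at
    (h : IsHamiltonianSystemWithSymmetry Ω J μ H) (g : G) (x : M) (u v : E) :
    Ω.at (g • x) ![modelDeriv E E (fun y : M => g • y) x u,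
      modelDeriv E E (fun y : M => g • y) x v] = Ω.at x ![u, v] := by
  rw [← pullbackForm_at, h.symplectic_action g]

theorem IsReducedManifold.mdifferentiableAt_val (hP : IsReducedManifold E EL EP G J μ)
    (l : MomentumLevel J μ) :
    MDifferentiableAt 𝓘(ℝ, EL) 𝓘(ℝ, E) (Subtype.val : MomentumLevel J μ → M) l :=
  hP.level_embedded.contMDiff.contMDiffAt.mdifferentiableAt (by simp)

theorem IsReducedManifold.contMDiff_proj (hP : IsReducedManifold E EL EP G J μ) :
    ContMDiff 𝓘(ℝ, EL) 𝓘(ℝ, EP) ∞ (reducedProj G J μ) :=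
  hP.proj_submersion.contMDiff

theorem IsReducedManifold.mdifferentiableAt_proj (hP : IsReducedManifold E EL EP G J μ)
    (l : MomentumLevel J μ) :
    MDifferentiableAt 𝓘(ℝ, EL) 𝓘(ℝ, EP) (reducedProj G J μ) l :=
  hP.contMDiff_proj.contMDiffAt.mdifferentiableAt (by simp)

theorem IsReducedManifold.val_injective (hP : IsReducedManifold E EL EP G J μ)
    (l : MomentumLevel J μ) {u v : EL}
    (huv : modelDeriv EL E (Subtype.val : MomentumLevel J μ → M) l u =
      modelDeriv EL E (Subtype.val : MomentumLevel J μ → M) l v) : u = v :=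
  have := hP.level_manifold
  (hP.level_embedded.isImmersion.isImmersionAt l).modelDeriv_injective huv

theorem IsReducedManifold.proj_surjective (hP : IsReducedManifold E EL EP G J μ)
    (l : MomentumLevel J μ) (w : EP) : ∃ u : EL, modelDeriv EL EP (reducedProj G J μ) l u = w :=
  have := hP.level_manifold
  have := hP.quotient_manifold
  (hP.proj_submersion.isSubmersionAt l).modelDeriv_surjective w

/-- A curve in the level set which is differentiable in `M` is differentiable in the level set. -/
theorem IsReducedManifold.exists_hasVelocityAt_lift (hP : IsReducedManifold E EL EP G J μ)
    (l : MomentumLevel J μ) {c : ℝ → M} {w : E} (hc0 : c 0 = l) (hc : HasVelocityAt c w)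
    (hJ : ∀ᶠ t in 𝓝 0, J (c t) = μ) :
    ∃ (k : ℝ → MomentumLevel J μ) (u : EL), k 0 = l ∧ HasVelocityAt k u ∧
      (∀ᶠ t in 𝓝 0, (k t : M) = c t) ∧
      modelDeriv EL E (Subtype.val : MomentumLevel J μ → M) l u = w := by
  classical
  have := hP.level_manifold
  -- The value `l` off the level set is a filler: near `0` the curve lies in the level set.
  let k : ℝ → MomentumLevel J μ := fun t => if h : J (c t) = μ then ⟨c t, h⟩ else l
  have hkc : ∀ᶠ t in 𝓝 0, (k t : M) = c t := by
    filter_upwards [hJ] with t ht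
    simp [k, ht]
  have hk0 : k 0 = l := by
    have h0 : J (c 0) = μ := by rw [hc0]; exact l.2
    simp only [k, h0, dif_pos]
    exact Subtype.ext hc0
  have hkv : HasVelocityAt (Subtype.val ∘ k) w := hc.congr hkc
  have hkcont : ContinuousAt k 0 :=
    Topology.IsInducing.subtypeVal.continuousAt_iff.2 hkv.continuousAt
  obtain ⟨u, hu, huw⟩ := (hP.level_embedded.isImmersion.isImmersionAt l).exists_hasVelocityAt_of_comp
    hk0 hkcont hkv
  exact ⟨k, u, hk0, hu, hkc, huw⟩

/-- Vectors tangent to the level set are symplectically orthogonal to the orbit directions. -/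
theorem IsReducedManifold.generator_orthogonal (hP : IsReducedManifold E EL EP G J μ)
    (h : IsHamiltonianSystemWithSymmetry Ω J μ H) (l : MomentumLevel J μ) (ξ : EG) (u : EL) :
    Ω.at (l : M) ![generatorMap EG E G (l : M) ξ,
      modelDeriv EL E (Subtype.val : MomentumLevel J μ → M) l u] = 0 := by
  have := hP.level_manifold
  rw [h.momentum_apply]
  obtain ⟨c, hc0, hc⟩ := exists_hasVelocityAt l u
  have h1 := hc.comp hc0 (hP.mdifferentiableAt_val l)
  have h2 := h1.comp (f := fun y => J y ξ) (x := (l : M)) (by simp [hc0])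
    ((h.momentum_smooth ξ).contMDiffAt.mdifferentiableAt (by simp))
  refine h2.unique ((hasVelocityAt_const (μ ξ)).congr (Eventually.of_forall fun t => ?_))
  exact congrArg (fun A : Module.Dual ℝ (GroupLieAlgebra 𝓘(ℝ, EG) G) => A ξ) (c t).2

/-- The tangent space of the level set is the symplectic complement of the orbit directions. -/
theorem IsReducedManifold.exists_val_eq (hP : IsReducedManifold E EL EP G J μ)
    (h : IsHamiltonianSystemWithSymmetry Ω J μ H) (l : MomentumLevel J μ) {w : E}
    (hw : ∀ ξ : EG, Ω.at (l : M) ![generatorMap EG E G (l : M) ξ, w] = 0) :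
    ∃ u : EL, modelDeriv EL E (Subtype.val : MomentumLevel J μ → M) l u = w := by
  let b := Module.finBasis ℝ EG
  let f : M → (Fin (Module.finrank ℝ EG) → ℝ) := fun y i => J y (b i)
  have hf : ContMDiff 𝓘(ℝ, E) 𝓘(ℝ, Fin (Module.finrank ℝ EG) → ℝ) ∞ f :=
    contMDiff_pi_space.2 fun i => h.momentum_smooth (b i)
  have hfd : ∀ v i, modelDeriv E (Fin (Module.finrank ℝ EG) → ℝ) f (l : M) v i =
      Ω.at (l : M) ![generatorMap EG E G (l : M) (b i), v] := by
    intro v i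
    rw [h.momentum_apply]
    let p : (Fin (Module.finrank ℝ EG) → ℝ) →L[ℝ] ℝ := ContinuousLinearMap.proj i
    have hp : modelDeriv (Fin (Module.finrank ℝ EG) → ℝ) ℝ p (f l) = p :=
      p.hasMFDerivAt.mfderiv
    have h1 := modelDeriv_comp (l : M) (g := p) (f := f)
      (p.contDiff.contMDiff.contMDiffAt.mdifferentiableAt (n := ∞) (by simp))
      (hf.contMDiffAt.mdifferentiableAt (by simp))
    rw [hp] at h1
    exact (DFunLike.congr_fun h1 v).symm
  have hinj : ∀ ξ : EG, generatorMap EG E G (l : M) ξ = 0 → ξ = 0 := fun ξ hξ =>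
    generatorMap_injective (fun g hg => h.free g l hg) hξ
  -- Independent generators pair to independent functionals, so `l` is a regular point of `f` and
  -- `w` is the velocity of a curve in its level set.
  obtain ⟨c, hc0, hc, hfc⟩ := exists_hasVelocityAt_level hf (x := (l : M)) (w := w) (fun z => by
    obtain ⟨v, hv⟩ := exists_pairing_eq b (h.nondegenerate_at (l : M))
      (generatorMap EG E G (l : M)).toLinearMap hinj z
    exact ⟨v, funext fun i => (hfd v i).trans (hv i)⟩)
    (funext fun i => (hfd w i).trans (hw (b i)))
  obtain ⟨k, u, -, -, -, hu⟩ := hP.exists_hasVelocityAt_lift l hc0 hc (by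
    filter_upwards [hfc] with t ht
    rw [← l.2]
    exact b.ext (f₁ := (J (c t) : EG →ₗ[ℝ] ℝ)) (f₂ := (J (l : M) : EG →ₗ[ℝ] ℝ))
      fun i => congrFun ht i)
  exact ⟨u, hu⟩

/-- The kernel of the differential of the projection consists of the orbit directions. -/
theorem IsReducedManifold.exists_generator_eq [ProperSMul G M]
    (hP : IsReducedManifold E EL EP G J μ)
    (h : IsHamiltonianSystemWithSymmetry Ω J μ H) (l : MomentumLevel J μ) {u : EL}
    (hu : modelDeriv EL EP (reducedProj G J μ) l u = 0) :
    ∃ ξ : EG, generatorMap EG E G (l : M) ξ =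
      modelDeriv EL E (Subtype.val : MomentumLevel J μ → M) l u := by
  have := hP.level_manifold
  have := hP.quotient_manifold
  have : IsManifold 𝓘(ℝ, EG) ∞ G :=
    (inferInstance : ContMDiffMul 𝓘(ℝ, EG) ∞ G).toIsManifold
  obtain ⟨c, hc0, hc, hπ⟩ := (hP.proj_submersion.isSubmersionAt l).exists_hasVelocityAt_fibre hu
  have hex : ∀ t, ∃ g : G, reducedProj G J μ (c t) = reducedProj G J μ l →
      g • (l : M) = (c t : M) := by
    intro t
    by_cases ht : reducedProj G J μ (c t) = reducedProj G J μ l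
    · obtain ⟨g, hg⟩ := Quotient.exact ht
      exact ⟨g, fun _ => hg⟩
    · exact ⟨1, fun h => (ht h).elim⟩
  choose g hg using hex
  have hfree : ∀ k : G, k • (l : M) = l → k = 1 := fun k hk => h.free k l hk
  have hg0 : g 0 = 1 := hfree _ (by rw [hg 0 (by rw [hc0]), hc0])
  have hev : ∀ᶠ t in 𝓝 0, g t • (l : M) = c t := by
    filter_upwards [hπ] with t ht using hg t ht
  have hv : HasVelocityAt (fun t => g t • (l : M)) _ :=
    (hc.comp hc0 (hP.mdifferentiableAt_val l)).congr hev
  -- The `g t` were chosen pointwise; properness and freeness force them to depend continuously on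
  -- `g t • l`. The immersivity of the orbit map then makes the curve differentiable.
  have hgc : ContinuousAt g 0 := (isInducing_orbitMap hfree).continuousAt_iff.2 hv.continuousAt
  obtain ⟨ξ, -, hξ⟩ := exists_hasVelocityAt_of_comp_of_injective (x := (1 : G))
    (contMDiff_orbitMap (EG := EG) (E := E) (l : M))
    (fun ξ hξ => generatorMap_injective hfree hξ) hg0 hgc hv
  exact ⟨ξ, hξ⟩

/-- A group curve with velocity `ξ` moves `l` inside the level set along one orbit, so its
projection is constant. Its velocity in the level set is `u`, because the inclusion is an immersion.
-/
theorem IsReducedManifold.proj_eq_zero_of_generator (hP : IsReducedManifold E EL EP G J μ)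
    (h : IsHamiltonianSystemWithSymmetry Ω J μ H) (l : MomentumLevel J μ) {u : EL} {ξ : EG}
    (hu : generatorMap EG E G (l : M) ξ =
      modelDeriv EL E (Subtype.val : MomentumLevel J μ → M) l u) :
    modelDeriv EL EP (reducedProj G J μ) l u = 0 := by
  have : IsManifold 𝓘(ℝ, EG) ∞ G :=
    (inferInstance : ContMDiffMul 𝓘(ℝ, EG) ∞ G).toIsManifold
  obtain ⟨g, hg0, hg⟩ := exists_hasVelocityAt (1 : G) ξ
  have h1 : HasVelocityAt (fun t => g t • (l : M)) (generatorMap EG E G (l : M) ξ) :=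
    hg.comp hg0 ((contMDiff_orbitMap (l : M)).contMDiffAt.mdifferentiableAt (by simp))
  obtain ⟨k, v, hk0, hk, hkg, hv⟩ := hP.exists_hasVelocityAt_lift l (by simp [hg0]) h1
    (Eventually.of_forall fun t => h.level_invariant _ _ l.2)
  rw [hu] at hv
  rw [← hP.val_injective l hv]
  have h2 := hk.comp hk0 (hP.mdifferentiableAt_proj l)
  refine h2.unique ((hasVelocityAt_const (reducedProj G J μ l)).congr ?_)
  filter_upwards [hkg] with t ht
  exact Quotient.sound ⟨g t, ht.symm⟩

/-- The kernel of the restricted form is the kernel of the differential of the projection. -/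
theorem IsReducedManifold.proj_eq_zero_iff [ProperSMul G M]
    (hP : IsReducedManifold E EL EP G J μ)
    (h : IsHamiltonianSystemWithSymmetry Ω J μ H) (l : MomentumLevel J μ) (u : EL) :
    modelDeriv EL EP (reducedProj G J μ) l u = 0 ↔
      ∀ v : EL, (levelForm EL Ω J μ).at l ![u, v] = 0 := by
  simp only [levelForm, pullbackForm_at]
  constructor
  · intro hu v
    obtain ⟨ξ, hξ⟩ := hP.exists_generator_eq h l hu
    rw [← hξ]
    exact hP.generator_orthogonal h l ξ v
  · intro hu
    -- A null vector is orthogonal to the tangent space of the level set, that is, to the complement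
    -- of the generators; it lies in their double complement and so is a generator vector.
    obtain ⟨ξ, hξ⟩ := exists_eq_of_symplectic_complement (Module.finBasis ℝ EG)
      (h.nondegenerate_at (l : M)) (generatorMap EG E G (l : M)).toLinearMap
      (a := modelDeriv EL E (Subtype.val : MomentumLevel J μ → M) l u) (fun v hv => by
        obtain ⟨v', rfl⟩ := hP.exists_val_eq h l hv
        exact hu v')
    exact hP.proj_eq_zero_of_generator h l hξ

/-- The action of `g` on the level set. -/
def levelSmul (h : IsHamiltonianSystemWithSymmetry Ω J μ H) (g : G) (l : MomentumLevel J μ) :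
    MomentumLevel J μ :=
  ⟨g • (l : M), h.level_invariant g l l.2⟩

/-- A continuous map into the source of an immersion is smooth as soon as its composite with the
immersion is. -/
theorem IsReducedManifold.contMDiff_levelSmul (hP : IsReducedManifold E EL EP G J μ)
    (h : IsHamiltonianSystemWithSymmetry Ω J μ H) (g : G) :
    ContMDiff 𝓘(ℝ, EL) 𝓘(ℝ, EL) ∞ (levelSmul h g) := by
  have := hP.level_manifold
  have h1 : ContMDiff 𝓘(ℝ, EL) 𝓘(ℝ, E) ∞ (fun l : MomentumLevel J μ => g • (l : M)) :=
    (contMDiff_smul_left (EG := EG) g).comp hP.level_embedded.contMDiff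
  exact (ContMDiff.iff_comp_isImmersion hP.level_embedded.isImmersion).2
    ⟨h1.continuous.subtype_mk _, h1⟩

theorem IsReducedManifold.levelForm_levelSmul (hP : IsReducedManifold E EL EP G J μ)
    (h : IsHamiltonianSystemWithSymmetry Ω J μ H) (g : G) (l : MomentumLevel J μ) (u v : EL) :
    (levelForm EL Ω J μ).at (levelSmul h g l) ![modelDeriv EL EL (levelSmul h g) l u,
      modelDeriv EL EL (levelSmul h g) l v] = (levelForm EL Ω J μ).at l ![u, v] := by
  have hs := (hP.contMDiff_levelSmul h g).contMDiffAt.mdifferentiableAt (x := l) (by simp)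
  have h1 : ∀ w, modelDeriv EL E (Subtype.val : MomentumLevel J μ → M) (levelSmul h g l)
      (modelDeriv EL EL (levelSmul h g) l w) = modelDeriv E E (fun y : M => g • y) (l : M)
        (modelDeriv EL E (Subtype.val : MomentumLevel J μ → M) l w) := by
    intro w
    have e1 := modelDeriv_comp l (hP.mdifferentiableAt_val (levelSmul h g l)) hs
    have e2 := modelDeriv_comp l (g := fun y : M => g • y)
      ((contMDiff_smul_left (EG := EG) (E := E) g).contMDiffAt.mdifferentiableAt (by simp))
      (hP.mdifferentiableAt_val l)
    have e3 : Subtype.val ∘ levelSmul h g = (fun y : M => g • y) ∘ Subtype.val := rfl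
    rw [e3, e2] at e1
    exact (DFunLike.congr_fun e1 w).symm
  simp only [levelForm, pullbackForm_at, h1]
  exact h.invariant_at g _ _ _

theorem IsReducedManifold.proj_levelSmul (hP : IsReducedManifold E EL EP G J μ)
    (h : IsHamiltonianSystemWithSymmetry Ω J μ H) (g : G) (l : MomentumLevel J μ) (u : EL) :
    modelDeriv EL EP (reducedProj G J μ) (levelSmul h g l) (modelDeriv EL EL (levelSmul h g) l u) =
      modelDeriv EL EP (reducedProj G J μ) l u := by
  have hs := (hP.contMDiff_levelSmul h g).contMDiffAt.mdifferentiableAt (x := l) (by simp)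
  have e1 := modelDeriv_comp l (hP.mdifferentiableAt_proj (levelSmul h g l)) hs
  have e2 : reducedProj G J μ ∘ levelSmul h g = reducedProj G J μ :=
    funext fun k => Quotient.sound ⟨g, rfl⟩
  rw [e2] at e1
  exact (DFunLike.congr_fun e1 u).symm

/-- Lifts of the same vector differ by a null vector of the restricted form. This makes the
descended form independent of the chosen lifts. -/
theorem IsReducedManifold.levelForm_congr [ProperSMul G M]
    (hP : IsReducedManifold E EL EP G J μ)
    (h : IsHamiltonianSystemWithSymmetry Ω J μ H) (l : MomentumLevel J μ) {u u' v v' : EL}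
    (hu : modelDeriv EL EP (reducedProj G J μ) l u = modelDeriv EL EP (reducedProj G J μ) l u')
    (hv : modelDeriv EL EP (reducedProj G J μ) l v = modelDeriv EL EP (reducedProj G J μ) l v') :
    (levelForm EL Ω J μ).at l ![u, v] = (levelForm EL Ω J μ).at l ![u', v'] := by
  have key : ∀ {a b c : EL}, modelDeriv EL EP (reducedProj G J μ) l a =
      modelDeriv EL EP (reducedProj G J μ) l b →
      (levelForm EL Ω J μ).at l ![a, c] = (levelForm EL Ω J μ).at l ![b, c] := by
    intro a b c hab
    have h1 := (hP.proj_eq_zero_iff h l (a - b)).1 (by rw [map_sub, hab, sub_self]) c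
    have h2 : pairing ((levelForm EL Ω J μ).at l) (a - b) c = 0 := h1
    rw [map_sub, LinearMap.sub_apply, sub_eq_zero] at h2
    exact h2
  rw [key hu, alternating_swap, key hv, ← alternating_swap]

/-- The reduced form exists. -/
theorem IsReducedManifold.isReducedForm_reducedForm [FiniteDimensional ℝ EP] [ProperSMul G M]
    (hP : IsReducedManifold E EL EP G J μ) (h : IsHamiltonianSystemWithSymmetry Ω J μ H) :
    IsReducedForm EL G Ω J μ (reducedForm EL EP G Ω J μ) := by
  refine Classical.epsilon_spec (p := IsReducedForm EL G Ω J μ) ?_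
  have hσ : ∀ l : MomentumLevel J μ, ∃ σ : EP →L[ℝ] EL, ∀ w,
      modelDeriv EL EP (reducedProj G J μ) l (σ w) = w := by
    intro l
    obtain ⟨σ, hσ⟩ := LinearMap.exists_rightInverse_of_surjective
      (modelDeriv EL EP (reducedProj G J μ) l).toLinearMap
      (LinearMap.range_eq_top.2 (hP.proj_surjective l))
    exact ⟨σ.toContinuousLinearMap, fun w => LinearMap.congr_fun hσ w⟩
  choose σ hσ using hσ
  -- The form is evaluated at the chosen representative `p.out` on lifts by a linear section `σ` of
  -- the differential. At another point `l` of the fibre, a group element carries `l` to `p.out`,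
  -- preserving both the restricted form and the projection.
  let η₀ : ReducedSpace G J μ → EP [⋀^Fin 2]→L[ℝ] ℝ := fun p =>
    ((levelForm EL Ω J μ).at p.out).compContinuousLinearMap (σ p.out)
  let η : TwoForm EP (ReducedSpace G J μ) := η₀
  have hη : ∀ p u v, η.at p ![u, v] =
      (levelForm EL Ω J μ).at p.out ![σ p.out u, σ p.out v] := fun p u v =>
    compContinuousLinearMap_pair _ _ _ _
  refine ⟨η, TwoForm.ext_at fun l u v => ?_⟩
  rw [pullbackForm_at, hη]
  obtain ⟨g, hg⟩ := Quotient.mk_out (s := levelOrbitSetoid G J μ) l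
  have hgl : levelSmul h g l = (reducedProj G J μ l).out := Subtype.ext hg
  rw [← hgl, ← hP.levelForm_levelSmul h g l u v]
  refine hP.levelForm_congr h _ ?_ ?_
  · rw [hσ, hP.proj_levelSmul h]
  · rw [hσ, hP.proj_levelSmul h]

theorem IsReducedForm.apply_proj {η : TwoForm EP (ReducedSpace G J μ)}
    (hη : IsReducedForm EL G Ω J μ η) (l : MomentumLevel J μ) (u v : EL) :
    η.at (reducedProj G J μ l) ![modelDeriv EL EP (reducedProj G J μ) l u,
      modelDeriv EL EP (reducedProj G J μ) l v] = (levelForm EL Ω J μ).at l ![u, v] := by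
  rw [← pullbackForm_at]
  exact congrArg (fun B : TwoForm EL (MomentumLevel J μ) => B.at l ![u, v]) hη

/-- The reduced form is nondegenerate. -/
theorem IsReducedManifold.nondegenerateForm_of_isReducedForm [ProperSMul G M]
    (hP : IsReducedManifold E EL EP G J μ) (h : IsHamiltonianSystemWithSymmetry Ω J μ H)
    {η : TwoForm EP (ReducedSpace G J μ)} (hη : IsReducedForm EL G Ω J μ η) :
    NondegenerateForm η := by
  intro p a ha
  obtain ⟨l, rfl⟩ := Quotient.exists_rep p
  obtain ⟨u, rfl⟩ := hP.proj_surjective l a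
  refine (hP.proj_eq_zero_iff h l u).2 fun v => ?_
  rw [← hη.apply_proj]
  exact ha _

end Reduced

/-! ### Hamiltonian vector fields and their smoothness. -/

section Calculus

/-- A basis of `E` identifies operators with tuples of values. Smoothness of an operator-valued map
can thus be checked on coefficients. -/
theorem contDiffAt_clm_apply {D : Type*} [NormedAddCommGroup D] [NormedSpace ℝ D]
    {E : Type*} [NormedAddCommGroup E] [NormedSpace ℝ E] [FiniteDimensional ℝ E]
    {F : Type*} [NormedAddCommGroup F] [NormedSpace ℝ F] {n : ℕ∞ω} {f : D → E →L[ℝ] F} {x : D} :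
    ContDiffAt ℝ n f x ↔ ∀ y, ContDiffAt ℝ n (fun x => f x y) x := by
  refine ⟨fun h y => h.clm_apply contDiffAt_const, fun h => ?_⟩
  let d := Module.finrank ℝ E
  have hd : d = Module.finrank ℝ (Fin d → ℝ) := (Module.finrank_fin_fun ℝ).symm
  let e₁ := ContinuousLinearEquiv.ofFinrankEq hd
  let e₂ := (e₁.arrowCongr (1 : F ≃L[ℝ] F)).trans (ContinuousLinearEquiv.piRing (Fin d))
  rw [← Function.id_comp f, ← e₂.symm_comp_self]
  exact e₂.symm.contDiff.contDiffAt.comp x (contDiffAt_pi.mpr fun i => h _)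

end Calculus

section HamiltonianVectorField

variable {E : Type*} [NormedAddCommGroup E] [NormedSpace ℝ E]
  {M : Type*} [TopologicalSpace M] [ChartedSpace E M]
  {E' : Type*} [NormedAddCommGroup E'] [NormedSpace ℝ E']
  {N : Type*} [TopologicalSpace N] [ChartedSpace E' N]

/-- The Hamiltonian vector field, with values in the model space. -/
def hamiltonianField (Ω : TwoForm E M) (H : M → ℝ) (x : M) : E := hamiltonianVectorField Ω H x

theorem TwoForm.flat_bijective [FiniteDimensional ℝ E] {B : E [⋀^Fin 2]→L[ℝ] ℝ}
    (hB : ∀ u : E, (∀ v, B ![u, v] = 0) → u = 0) : Function.Bijective (pairing B) := by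
  have hinj : Function.Injective (pairing B) := by
    rw [← LinearMap.ker_eq_bot, LinearMap.ker_eq_bot']
    exact fun u hu => hB u fun v => LinearMap.congr_fun hu v
  exact ⟨hinj, (LinearMap.injective_iff_surjective_of_finrank_eq_finrank
    Subspace.dual_finrank_eq.symm).1 hinj⟩

theorem NondegenerateForm.hamiltonianField_apply [FiniteDimensional ℝ E] {Ω : TwoForm E M}
    (hΩ : NondegenerateForm Ω) (H : M → ℝ) (x : M) (w : E) :
    Ω.at x ![hamiltonianField Ω H x, w] = modelDeriv E ℝ H x w := by
  have hex : ∃ X : TangentSpace 𝓘(ℝ, E) x, IsHamiltonianVector Ω H x X := by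
    obtain ⟨X, hX⟩ := (TwoForm.flat_bijective (B := Ω.at x) (hΩ x)).2
      (modelDeriv E ℝ H x).toLinearMap
    exact ⟨X, fun w => LinearMap.congr_fun hX w⟩
  exact Classical.epsilon_spec hex w

theorem NondegenerateForm.eq_hamiltonianField [FiniteDimensional ℝ E] {Ω : TwoForm E M}
    (hΩ : NondegenerateForm Ω) {H : M → ℝ} {x : M} {u : E}
    (hu : ∀ w, Ω.at x ![u, w] = modelDeriv E ℝ H x w) : hamiltonianField Ω H x = u :=
  (TwoForm.flat_bijective (B := Ω.at x) (hΩ x)).1 (LinearMap.ext fun w =>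
    (hΩ.hamiltonianField_apply H x w).trans (hu w).symm)

/-- The linear equivalence of the model space with its dual given by a nondegenerate form. -/
def flatMap [FiniteDimensional ℝ E] (B : E [⋀^Fin 2]→L[ℝ] ℝ) : E →L[ℝ] E →L[ℝ] ℝ :=
  ((LinearMap.toContinuousLinearMap (𝕜 := ℝ) (E := E) (F' := ℝ)).toLinearMap ∘ₗ
    pairing B).toContinuousLinearMap

theorem flatMap_apply [FiniteDimensional ℝ E] (B : E [⋀^Fin 2]→L[ℝ] ℝ) (u v : E) :
    flatMap B u v = B ![u, v] := rfl

theorem exists_flatEquiv [FiniteDimensional ℝ E] {B : E [⋀^Fin 2]→L[ℝ] ℝ}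
    (hB : ∀ u : E, (∀ v, B ![u, v] = 0) → u = 0) :
    ∃ A : E ≃L[ℝ] E →L[ℝ] ℝ, (A : E →L[ℝ] E →L[ℝ] ℝ) = flatMap B := by
  let e : E ≃ₗ[ℝ] E →L[ℝ] ℝ :=
    (LinearEquiv.ofBijective (pairing B) (TwoForm.flat_bijective hB)).trans
      (LinearMap.toContinuousLinearMap (𝕜 := ℝ) (E := E) (F' := ℝ))
  exact ⟨e.toContinuousLinearEquiv, by ext u v; rfl⟩

/-- A smooth Hamiltonian has a continuously differentiable Hamiltonian vector field for a
nondegenerate form which is smooth in charts. -/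
theorem NondegenerateForm.contMDiff_hamiltonianVectorField [FiniteDimensional ℝ E]
    [IsManifold 𝓘(ℝ, E) ∞ M] {Ω : TwoForm E M} (hΩ : NondegenerateForm Ω)
    (hsm : ∀ (x : M) (a b : E), ContDiffAt ℝ ∞
      (fun y => formInChart Ω x y ![a, b]) (extChartAt 𝓘(ℝ, E) x x))
    {H : M → ℝ} (hH : ContMDiff 𝓘(ℝ, E) 𝓘(ℝ, ℝ) ∞ H) :
    ContMDiff 𝓘(ℝ, E) 𝓘(ℝ, E).tangent 1
      (fun x => (⟨x, hamiltonianVectorField Ω H x⟩ : TangentBundle 𝓘(ℝ, E) M)) := by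
  have : CompleteSpace E := FiniteDimensional.complete ℝ E
  have : IsManifold 𝓘(ℝ, E) 1 M := IsManifold.of_le (n := ∞) (by simp)
  intro x
  set φ := extChartAt 𝓘(ℝ, E) x with hφ
  have hxφ : x ∈ φ.source := mem_extChartAt_source x
  have hφsrc : IsOpen φ.source := isOpen_extChartAt_source x
  have hφtgt : IsOpen φ.target := isOpen_extChartAt_target x
  have hφm : ContMDiffOn 𝓘(ℝ, E) 𝓘(ℝ, E) ∞ φ φ.source := by
    rw [hφ, extChartAt_source]
    exact contMDiffOn_extChartAt
  have hφsm : ContMDiffOn 𝓘(ℝ, E) 𝓘(ℝ, E) ∞ φ.symm φ.target := contMDiffOn_extChartAt_symm x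
  have hφd : ∀ z ∈ φ.source, MDifferentiableAt 𝓘(ℝ, E) 𝓘(ℝ, E) φ z := fun z hz =>
    (hφm.contMDiffAt (hφsrc.mem_nhds hz)).mdifferentiableAt (by simp)
  have hφsd : ∀ y ∈ φ.target, MDifferentiableAt 𝓘(ℝ, E) 𝓘(ℝ, E) φ.symm y := fun y hy =>
    (hφsm.contMDiffAt (hφtgt.mem_nhds hy)).mdifferentiableAt (by simp)
  have hleft : ∀ z ∈ φ.source, ∀ v, modelDeriv E E φ.symm (φ z) (modelDeriv E E φ z v) = v :=
    fun z hz => modelDeriv_leftInverse_apply (hφsd _ (φ.map_source hz)) (hφd z hz)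
      (Filter.eventually_of_mem (hφsrc.mem_nhds hz) fun _ h => φ.left_inv h)
  have hright : ∀ z ∈ φ.source, ∀ v, modelDeriv E E φ z (modelDeriv E E φ.symm (φ z) v) = v := by
    intro z hz v
    have := modelDeriv_leftInverse_apply (f := φ.symm) (r := φ) (x := φ z)
      (by rw [φ.left_inv hz]; exact hφd z hz) (hφsd _ (φ.map_source hz))
      (Filter.eventually_of_mem (hφtgt.mem_nhds (φ.map_source hz)) fun _ h => φ.right_inv h) v
    rwa [φ.left_inv hz] at this
  let β : E → E [⋀^Fin 2]→L[ℝ] ℝ := formInChart Ω x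
  have hβ : ∀ y a b, β y ![a, b] =
      Ω.at (φ.symm y) ![modelDeriv E E φ.symm y a, modelDeriv E E φ.symm y b] := fun y a b =>
    pullbackForm_at (E := E) (M := E) φ.symm Ω y a b
  have hβnd : ∀ z ∈ φ.source, ∀ u : E, (∀ v, β (φ z) ![u, v] = 0) → u = 0 := by
    intro z hz u hu
    have h1 : modelDeriv E E φ.symm (φ z) u = 0 := by
      refine hΩ z _ fun (v : E) => ?_
      have h2 := hu (modelDeriv E E φ z v)
      rw [hβ, hleft z hz, φ.left_inv hz] at h2
      exact h2
    rw [← hright z hz u, h1, map_zero]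
  let dH : E → E →L[ℝ] ℝ := fderiv ℝ (H ∘ φ.symm)
  have hdH : ∀ z ∈ φ.source, ∀ b, dH (φ z) b =
      modelDeriv E ℝ H z (modelDeriv E E φ.symm (φ z) b) := by
    intro z hz b
    have h1 := modelDeriv_comp (φ z) (f := φ.symm) (g := H)
      (hH.contMDiffAt.mdifferentiableAt (by simp)) (hφsd _ (φ.map_source hz))
    have h2 : modelDeriv E ℝ (H ∘ φ.symm) (φ z) = dH (φ z) := mfderiv_eq_fderiv
    rw [φ.left_inv hz, h2] at h1
    exact DFunLike.congr_fun h1 b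
  have hdHs : ContDiffAt ℝ 1 dH (φ x) := by
    have h1 : ContDiffAt ℝ ∞ (H ∘ φ.symm) (φ x) :=
      (hH.contMDiffAt.comp (φ x)
        (hφsm.contMDiffAt (hφtgt.mem_nhds (φ.map_source hxφ)))).contDiffAt
    exact h1.fderiv_right (WithTop.coe_le_coe.2 le_top)
  have hflat : ContDiffAt ℝ 1 (fun y => flatMap (β y)) (φ x) := by
    refine contDiffAt_clm_apply.2 fun a => contDiffAt_clm_apply.2 fun b => ?_
    exact (hsm x a b).of_le (by simp)
  obtain ⟨A, hA⟩ := exists_flatEquiv (hβnd x hxφ)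
  -- The Hamiltonian field in the chart. `ContinuousLinearMap.inverse` is a genuine inverse on the
  -- chart target by nondegeneracy, and it is smooth at invertible maps.
  let X : E → E := fun y => (flatMap (β y)).inverse (dH y)
  have hX : ContDiffAt ℝ 1 X (φ x) := by
    have h1 : ContDiffAt ℝ 1 (ContinuousLinearMap.inverse : (E →L[ℝ] E →L[ℝ] ℝ) → _)
      (flatMap (β (φ x))) := hA ▸ contDiffAt_map_inverse A
    exact (h1.comp (φ x) hflat).clm_apply hdHs
  have hXs : ContMDiffAt 𝓘(ℝ, E) 𝓘(ℝ, E).tangent 1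
      (fun y => (⟨y, X y⟩ : TangentBundle 𝓘(ℝ, E) E)) (φ x) :=
    contMDiffAt_vectorSpace_iff_contDiffAt.2 hX
  have hpull := ContMDiffAt.mpullback_vectorField_preimage (n := ∞) hXs
    (hφm.contMDiffAt (hφsrc.mem_nhds hxφ)) (isInvertible_mfderiv_extChartAt hxφ)
    (WithTop.coe_le_coe.2 le_top)
  refine hpull.congr_of_eventuallyEq ?_
  filter_upwards [hφsrc.mem_nhds hxφ] with z hz
  have hinv : (modelDeriv E E φ z).inverse = modelDeriv E E φ.symm (φ z) :=
    ContinuousLinearMap.inverse_eq (ContinuousLinearMap.ext (hright z hz))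
      (ContinuousLinearMap.ext (hleft z hz))
  obtain ⟨Az, hAz⟩ := exists_flatEquiv (hβnd z hz)
  have hXz : ∀ b, β (φ z) ![X (φ z), b] = dH (φ z) b := by
    intro b
    rw [← flatMap_apply, ← hAz]
    simp [X, ← hAz]
  have key : hamiltonianField Ω H z = modelDeriv E E φ.symm (φ z) (X (φ z)) := by
    refine hΩ.eq_hamiltonianField fun w => ?_
    have h1 := hXz (modelDeriv E E φ z w)
    rw [hβ, hdH z hz, hleft z hz, φ.left_inv hz] at h1
    exact h1
  have key2 : hamiltonianField Ω H z = (modelDeriv E E φ z).inverse (X (φ z)) := by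
    rw [hinv, key]
  exact congrArg (fun v : E => (⟨z, v⟩ : TangentBundle 𝓘(ℝ, E) M)) key2

theorem contDiff_alternating_apply (m : Fin 2 → E) :
    ContDiff ℝ ∞ (fun B : E [⋀^Fin 2]→L[ℝ] ℝ => B m) :=
  ((ContinuousMultilinearMap.apply ℝ (fun _ : Fin 2 => E) ℝ m).comp
    (ContinuousAlternatingMap.toContinuousMultilinearMapCLM ℝ)).contDiff

/-- The pullback of a smooth form by a smooth map from a vector space has smooth coefficients. -/
theorem IsSymplecticForm.contDiffAt_pullback [FiniteDimensional ℝ E] [IsManifold 𝓘(ℝ, E) ∞ M] {Ω : TwoForm E M}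
    (hΩ : IsSymplecticForm Ω) {W : Set E'} (hW : IsOpen W) {j : E' → M}
    (hj : ContMDiffOn 𝓘(ℝ, E') 𝓘(ℝ, E) ∞ j W) {y₀ : E'} (hy₀ : y₀ ∈ W) (a b : E') :
    ContDiffAt ℝ ∞ (fun y => Ω.at (j y) ![modelDeriv E' E j y a, modelDeriv E' E j y b]) y₀ := by
  set χ := extChartAt 𝓘(ℝ, E) (j y₀) with hχ
  have hχsrc : IsOpen χ.source := isOpen_extChartAt_source _
  have hχtgt : IsOpen χ.target := isOpen_extChartAt_target _
  have hχm : ContMDiffOn 𝓘(ℝ, E) 𝓘(ℝ, E) ∞ χ χ.source := by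
    rw [hχ, extChartAt_source]
    exact contMDiffOn_extChartAt
  have hχsm : ContMDiffOn 𝓘(ℝ, E) 𝓘(ℝ, E) ∞ χ.symm χ.target := contMDiffOn_extChartAt_symm _
  let W' : Set E' := W ∩ j ⁻¹' χ.source
  have hW' : IsOpen W' := hj.continuousOn.isOpen_inter_preimage hW hχsrc
  have hy₀' : y₀ ∈ W' := ⟨hy₀, mem_extChartAt_source _⟩
  let m : E' → E := χ ∘ j
  have hm : ContDiffOn ℝ ∞ m W' :=
    contMDiffOn_iff_contDiffOn.1 (hχm.comp (hj.mono inter_subset_left) fun y hy => hy.2)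
  have hmd : ∀ c : E', ContDiffAt ℝ ∞ (fun y => fderiv ℝ m y c) y₀ := fun c =>
    ((hm.contDiffAt (hW'.mem_nhds hy₀')).fderiv_right (m := ∞) (by simp)).clm_apply
      contDiffAt_const
  have hform : ContDiffAt ℝ ∞ (fun y => (formInChart Ω (j y₀) : E → E [⋀^Fin 2]→L[ℝ] ℝ) (m y))
      y₀ :=
    ((hΩ.smooth (j y₀)).contDiffAt (hχtgt.mem_nhds (χ.map_source hy₀'.2))).comp y₀
      (hm.contDiffAt (hW'.mem_nhds hy₀'))
  have hcoef : ContDiffAt ℝ ∞ (fun y =>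
      (formInChart Ω (j y₀) : E → E [⋀^Fin 2]→L[ℝ] ℝ) (m y) ![fderiv ℝ m y a, fderiv ℝ m y b])
      y₀ := by
    have hflat : ContDiffAt ℝ ∞ (fun y => flatMap (formInChart Ω (j y₀) (m y))) y₀ := by
      refine contDiffAt_clm_apply.2 fun c => contDiffAt_clm_apply.2 fun d => ?_
      exact (contDiff_alternating_apply ![c, d]).contDiffAt.comp y₀ hform
    exact (hflat.clm_apply (hmd a)).clm_apply (hmd b)
  refine hcoef.congr_of_eventuallyEq ?_
  filter_upwards [hW'.mem_nhds hy₀'] with y hy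
  have hjy : MDifferentiableAt 𝓘(ℝ, E') 𝓘(ℝ, E) j y :=
    (hj.contMDiffAt (hW.mem_nhds hy.1)).mdifferentiableAt (by simp)
  have hdm : ∀ c, modelDeriv E E χ.symm (m y) (fderiv ℝ m y c) = modelDeriv E' E j y c := by
    intro c
    have hχs : MDifferentiableAt 𝓘(ℝ, E) 𝓘(ℝ, E) χ.symm (m y) :=
      (hχsm.contMDiffAt (hχtgt.mem_nhds (χ.map_source hy.2))).mdifferentiableAt (by simp)
    have hmy : MDifferentiableAt 𝓘(ℝ, E') 𝓘(ℝ, E) m y :=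
      ((hm.contDiffAt (hW'.mem_nhds hy)).differentiableAt (by simp)).mdifferentiableAt
    have h1 := modelDeriv_comp y hχs hmy
    have h2 : modelDeriv E' E (χ.symm ∘ m) y = modelDeriv E' E j y := modelDeriv_congr (by
      filter_upwards [hW'.mem_nhds hy] with y' hy' using χ.left_inv hy'.2)
    have h3 : modelDeriv E' E m y = fderiv ℝ m y := mfderiv_eq_fderiv
    rw [h2, h3] at h1
    exact (DFunLike.congr_fun h1 c).symm
  have h4 := pullbackForm_at (E := E) (M := E) χ.symm Ω (m y) (fderiv ℝ m y a) (fderiv ℝ m y b)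
  rw [hdm, hdm, show χ.symm (m y) = j y from χ.left_inv hy.2] at h4
  exact h4.symm

end HamiltonianVectorField

/-! ### Topology and smoothness of the reduced system. -/

section ReducedSmooth

set_option linter.unusedSectionVars false

variable {E : Type*} [NormedAddCommGroup E] [NormedSpace ℝ E] [FiniteDimensional ℝ E]
  {M : Type*} [TopologicalSpace M] [T2Space M] [ChartedSpace E M] [IsManifold 𝓘(ℝ, E) ∞ M]
  {EG : Type*} [NormedAddCommGroup EG] [NormedSpace ℝ EG] [FiniteDimensional ℝ EG]
  {G : Type*} [TopologicalSpace G] [ChartedSpace EG G] [Group G] [LieGroup 𝓘(ℝ, EG) ∞ G]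
  [MulAction G M] [ContMDiffSMul 𝓘(ℝ, EG) 𝓘(ℝ, E) ∞ G M] [ProperSMul G M]
  {Ω : TwoForm E M} {J : M → Module.Dual ℝ (GroupLieAlgebra 𝓘(ℝ, EG) G)}
  {μ : Module.Dual ℝ (GroupLieAlgebra 𝓘(ℝ, EG) G)} {H : M → ℝ}
  {EL : Type*} [NormedAddCommGroup EL] [NormedSpace ℝ EL]
  [ChartedSpace EL (MomentumLevel J μ)]
  {EP : Type*} [NormedAddCommGroup EP] [NormedSpace ℝ EP]
  [ChartedSpace EP (ReducedSpace G J μ)]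

/-- The reduced phase space of a proper action is Hausdorff. -/
theorem t2Space_reducedSpace : T2Space (ReducedSpace G J μ) := by
  -- The reduced space injects continuously into the orbit space of `M`, which is Hausdorff since
  -- the action is proper.
  let q : ReducedSpace G J μ → Quotient (MulAction.orbitRel G M) :=
    Quotient.map (sa := levelOrbitSetoid G J μ) (sb := MulAction.orbitRel G M) Subtype.val
      fun _ _ h => h
  have hq : Continuous q := continuous_subtype_val.quotient_map' _
  have hinj : Function.Injective q := by
    intro p p' hpp'
    induction p, p' using Quotient.inductionOn₂ with
    | _ l l' => exact Quotient.sound (Quotient.exact (s := MulAction.orbitRel G M) hpp')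
  exact T2Space.of_injective_continuous hinj hq

theorem IsReducedManifold.exists_local_section (hP : IsReducedManifold E EL EP G J μ)
    (l : MomentumLevel J μ) :
    ∃ (s : ReducedSpace G J μ → MomentumLevel J μ) (U : Set (ReducedSpace G J μ)), IsOpen U ∧
      reducedProj G J μ l ∈ U ∧ s (reducedProj G J μ l) = l ∧
      ContMDiffOn 𝓘(ℝ, EP) 𝓘(ℝ, EL) ∞ s U ∧ ∀ y ∈ U, reducedProj G J μ (s y) = y :=
  have := hP.level_manifold
  have := hP.quotient_manifold
  (hP.proj_submersion.isSubmersionAt l).exists_local_section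

/-- A map on the reduced phase space is smooth if its lift to the level set is. -/
theorem IsReducedManifold.contMDiff_of_comp_proj (hP : IsReducedManifold E EL EP G J μ)
    {E' : Type*} [NormedAddCommGroup E'] [NormedSpace ℝ E']
    {N : Type*} [TopologicalSpace N] [ChartedSpace E' N] {f : ReducedSpace G J μ → N}
    (hf : ContMDiff 𝓘(ℝ, EL) 𝓘(ℝ, E') ∞ (f ∘ reducedProj G J μ)) :
    ContMDiff 𝓘(ℝ, EP) 𝓘(ℝ, E') ∞ f := by
  intro p
  obtain ⟨l, rfl⟩ := Quotient.exists_rep p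
  obtain ⟨s, U, hU, hlU, -, hs, hπs⟩ := hP.exists_local_section l
  have h1 : ContMDiffAt 𝓘(ℝ, EP) 𝓘(ℝ, E') ∞ ((f ∘ reducedProj G J μ) ∘ s) (reducedProj G J μ l) :=
    hf.contMDiffAt.comp _ (hs.contMDiffAt (hU.mem_nhds hlU))
  refine h1.congr_of_eventuallyEq ?_
  filter_upwards [hU.mem_nhds hlU] with y hy
  exact congrArg f (hπs y hy).symm

theorem IsReducedManifold.contMDiff_reducedHamiltonian (hP : IsReducedManifold E EL EP G J μ)
    (h : IsHamiltonianSystemWithSymmetry Ω J μ H) :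
    ContMDiff 𝓘(ℝ, EP) 𝓘(ℝ, ℝ) ∞ (reducedHamiltonian G J μ H h.hamiltonian_invariant) :=
  hP.contMDiff_of_comp_proj (h.hamiltonian_smooth.comp hP.level_embedded.contMDiff)

/-- The Hamiltonian vector field on the reduced phase space is continuously differentiable. -/
theorem IsReducedManifold.contMDiff_hamiltonianVectorField [FiniteDimensional ℝ EP]
    [IsManifold 𝓘(ℝ, EP) ∞ (ReducedSpace G J μ)] (hP : IsReducedManifold E EL EP G J μ) (h : IsHamiltonianSystemWithSymmetry Ω J μ H)
    {η : TwoForm EP (ReducedSpace G J μ)} (hη : IsReducedForm EL G Ω J μ η)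
    {K : ReducedSpace G J μ → ℝ} (hK : ContMDiff 𝓘(ℝ, EP) 𝓘(ℝ, ℝ) ∞ K) :
    ContMDiff 𝓘(ℝ, EP) 𝓘(ℝ, EP).tangent 1
      (fun p => (⟨p, hamiltonianVectorField η K p⟩ :
        TangentBundle 𝓘(ℝ, EP) (ReducedSpace G J μ))) := by
  refine (hP.nondegenerateForm_of_isReducedForm h hη).contMDiff_hamiltonianVectorField
    (fun p a b => ?_) hK
  obtain ⟨l, rfl⟩ := Quotient.exists_rep p
  change ContDiffAt ℝ ∞ (fun y => formInChart η (reducedProj G J μ l) y ![a, b])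
    (extChartAt 𝓘(ℝ, EP) (reducedProj G J μ l) (reducedProj G J μ l))
  -- Over `U` the reduced form is the pullback of `Ω` by the section followed by the inclusion, so
  -- its chart coefficients inherit smoothness from `Ω`.
  obtain ⟨s, U, hU, hlU, -, hs, hπs⟩ := hP.exists_local_section l
  set ψ := extChartAt 𝓘(ℝ, EP) (reducedProj G J μ l) with hψ
  have hψtgt : IsOpen ψ.target := isOpen_extChartAt_target _
  have hψsm : ContMDiffOn 𝓘(ℝ, EP) 𝓘(ℝ, EP) ∞ ψ.symm ψ.target := contMDiffOn_extChartAt_symm _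
  let W : Set EP := ψ.target ∩ ψ.symm ⁻¹' U
  have hW : IsOpen W := hψsm.continuousOn.isOpen_inter_preimage hψtgt hU
  have hlψ : reducedProj G J μ l ∈ ψ.source := mem_extChartAt_source _
  have hlW : ψ (reducedProj G J μ l) ∈ W :=
    ⟨ψ.map_source hlψ, by rwa [mem_preimage, ψ.left_inv hlψ]⟩
  have hsW : ContMDiffOn 𝓘(ℝ, EP) 𝓘(ℝ, EL) ∞ (s ∘ ψ.symm) W :=
    hs.comp (hψsm.mono inter_subset_left) fun y hy => hy.2
  have hj : ContMDiffOn 𝓘(ℝ, EP) 𝓘(ℝ, E) ∞ (Subtype.val ∘ (s ∘ ψ.symm)) W :=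
    hP.level_embedded.contMDiff.comp_contMDiffOn hsW
  refine (h.symplectic.contDiffAt_pullback hW hj hlW a b).congr_of_eventuallyEq ?_
  filter_upwards [hW.mem_nhds hlW] with y hy
  have hsy : MDifferentiableAt 𝓘(ℝ, EP) 𝓘(ℝ, EL) (s ∘ ψ.symm) y :=
    (hsW.contMDiffAt (hW.mem_nhds hy)).mdifferentiableAt (by simp)
  have h1 := modelDeriv_comp y (hP.mdifferentiableAt_val ((s ∘ ψ.symm) y)) hsy
  have h2 := modelDeriv_comp y (hP.mdifferentiableAt_proj ((s ∘ ψ.symm) y)) hsy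
  have h3 : modelDeriv EP EP (reducedProj G J μ ∘ (s ∘ ψ.symm)) y = modelDeriv EP EP ψ.symm y :=
    modelDeriv_congr (by filter_upwards [hW.mem_nhds hy] with z hz using hπs _ hz.2)
  have h4 : reducedProj G J μ ((s ∘ ψ.symm) y) = ψ.symm y := hπs _ hy.2
  have h5 := pullbackForm_at (E := EP) (M := EP) ψ.symm η y a b
  have h6 := hη.apply_proj ((s ∘ ψ.symm) y) (modelDeriv EP EL (s ∘ ψ.symm) y a)
    (modelDeriv EP EL (s ∘ ψ.symm) y b)
  rw [← ContinuousLinearMap.comp_apply, ← ContinuousLinearMap.comp_apply, ← h2, h3, h4,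
    levelForm, pullbackForm_at, ← ContinuousLinearMap.comp_apply, ← ContinuousLinearMap.comp_apply,
    ← h1] at h6
  exact h5.trans h6

end ReducedSmooth

/-! ### Symplectic maps and related Hamiltonian fields. -/

section RelatedForms

variable {E : Type*} [NormedAddCommGroup E] [NormedSpace ℝ E]
  {M : Type*} [TopologicalSpace M] [ChartedSpace E M]
  {E' : Type*} [NormedAddCommGroup E'] [NormedSpace ℝ E']
  {N : Type*} [TopologicalSpace N] [ChartedSpace E' N]

/-- A symplectic map between manifolds of the same dimension has bijective differentials. -/
theorem NondegenerateForm.exists_modelDeriv_equiv [FiniteDimensional ℝ E] [FiniteDimensional ℝ E']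
    (hdim : Module.finrank ℝ E = Module.finrank ℝ E') {Ω : TwoForm E M} {Ω' : TwoForm E' N}
    (hΩ : NondegenerateForm Ω) {f : M → N} (hf : pullbackForm f Ω' = Ω) (x : M) :
    ∃ A : E ≃L[ℝ] E', modelDeriv E E' f x = A := by
  have hinj : Function.Injective (modelDeriv E E' f x).toLinearMap := by
    rw [← LinearMap.ker_eq_bot, LinearMap.ker_eq_bot']
    intro u (hu : modelDeriv E E' f x u = 0)
    -- A vector killed by the differential is null for the pulled-back form `Ω`.
    refine hΩ x u fun v => ?_
    have h1 : Ω.at x ![u, v] = pairing (Ω'.at (f x)) (modelDeriv E E' f x u)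
        (modelDeriv E E' f x v) := by
      rw [← hf]
      exact pullbackForm_at f Ω' x u v
    rw [hu, map_zero] at h1
    exact h1
  exact ⟨(LinearEquiv.ofInjectiveOfFinrankEq _ hinj hdim).toContinuousLinearEquiv,
    by ext v; rfl⟩

/-- A symplectic map intertwining two Hamiltonians intertwines their Hamiltonian vector fields. -/
theorem NondegenerateForm.modelDeriv_hamiltonianField [FiniteDimensional ℝ E]
    [FiniteDimensional ℝ E']
    (hdim : Module.finrank ℝ E = Module.finrank ℝ E') {Ω : TwoForm E M} {Ω' : TwoForm E' N}
    (hΩ : NondegenerateForm Ω) (hΩ' : NondegenerateForm Ω') {f : M → N}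
    (hf : pullbackForm f Ω' = Ω) {x : M} (hfx : MDifferentiableAt 𝓘(ℝ, E) 𝓘(ℝ, E') f x)
    {H : M → ℝ} {H' : N → ℝ} (hH' : MDifferentiableAt 𝓘(ℝ, E') 𝓘(ℝ, ℝ) H' (f x))
    (hH : H = H' ∘ f) :
    modelDeriv E E' f x (hamiltonianField Ω H x) = hamiltonianField Ω' H' (f x) := by
  symm
  refine hΩ'.eq_hamiltonianField fun w => ?_
  obtain ⟨A, hA⟩ := hΩ.exists_modelDeriv_equiv hdim hf x
  -- Bijectivity of the differential allows the equation defining the target field to be tested on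
  -- image vectors only.
  obtain ⟨v, rfl⟩ : ∃ v, modelDeriv E E' f x v = w := ⟨A.symm w, by simp [hA]⟩
  rw [← pullbackForm_at, hf, hΩ.hamiltonianField_apply, hH, modelDeriv_comp x hH' hfx]
  rfl

theorem isMIntegralCurveOn_comp_of_related {f : M → N} (hf : MDifferentiable 𝓘(ℝ, E) 𝓘(ℝ, E') f)
    {X : ∀ x : M, TangentSpace 𝓘(ℝ, E) x} {Y : ∀ y : N, TangentSpace 𝓘(ℝ, E') y}
    (hXY : ∀ x, mfderiv 𝓘(ℝ, E) 𝓘(ℝ, E') f x (X x) = Y (f x)) {γ : ℝ → M} {s : Set ℝ}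
    (hγ : IsMIntegralCurveOn γ X s) : IsMIntegralCurveOn (f ∘ γ) Y s := by
  intro t ht
  have h1 := HasMFDerivAt.comp_hasMFDerivWithinAt t (hf (γ t)).hasMFDerivAt (hγ t ht)
  have e : ∀ (a : E) (b : E'), modelDeriv E E' f (γ t) a = b →
      (modelDeriv E E' f (γ t)).comp ((1 : ℝ →L[ℝ] ℝ).smulRight a) =
        (1 : ℝ →L[ℝ] ℝ).smulRight b := by
    rintro a _ rfl
    ext
    simp
  exact e (X (γ t)) (Y (f (γ t))) (hXY (γ t)) ▸ h1

end RelatedForms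

end Preliminaries

end

theorem mainTheorem7
    -- the manifolds `M₁`, `M₂`
    {E₁ : Type*} [NormedAddCommGroup E₁] [NormedSpace ℝ E₁] [FiniteDimensional ℝ E₁]
    {M₁ : Type*} [TopologicalSpace M₁] [T2Space M₁] [SecondCountableTopology M₁]
    [ChartedSpace E₁ M₁] [IsManifold 𝓘(ℝ, E₁) ∞ M₁]
    {E₂ : Type*} [NormedAddCommGroup E₂] [NormedSpace ℝ E₂] [FiniteDimensional ℝ E₂]
    {M₂ : Type*} [TopologicalSpace M₂] [T2Space M₂] [SecondCountableTopology M₂]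
    [ChartedSpace E₂ M₂] [IsManifold 𝓘(ℝ, E₂) ∞ M₂]
    -- the Lie groups `G₁`, `G₂` and their smooth proper actions
    {EG₁ : Type*} [NormedAddCommGroup EG₁] [NormedSpace ℝ EG₁] [FiniteDimensional ℝ EG₁]
    {G₁ : Type*} [TopologicalSpace G₁] [T2Space G₁] [SecondCountableTopology G₁]
    [ChartedSpace EG₁ G₁] [Group G₁] [LieGroup 𝓘(ℝ, EG₁) ∞ G₁]
    [MulAction G₁ M₁] [ContMDiffSMul 𝓘(ℝ, EG₁) 𝓘(ℝ, E₁) ∞ G₁ M₁] [ProperSMul G₁ M₁]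
    {EG₂ : Type*} [NormedAddCommGroup EG₂] [NormedSpace ℝ EG₂] [FiniteDimensional ℝ EG₂]
    {G₂ : Type*} [TopologicalSpace G₂] [T2Space G₂] [SecondCountableTopology G₂]
    [ChartedSpace EG₂ G₂] [Group G₂] [LieGroup 𝓘(ℝ, EG₂) ∞ G₂]
    [MulAction G₂ M₂] [ContMDiffSMul 𝓘(ℝ, EG₂) 𝓘(ℝ, E₂) ∞ G₂ M₂] [ProperSMul G₂ M₂]
    -- symplectic forms, momentum maps, momentum values, Hamiltonians
    (ω₁ : TwoForm E₁ M₁) (J₁ : M₁ → Module.Dual ℝ (GroupLieAlgebra 𝓘(ℝ, EG₁) G₁))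
    (μ₁ : Module.Dual ℝ (GroupLieAlgebra 𝓘(ℝ, EG₁) G₁)) (H₁ : M₁ → ℝ)
    (h₁ : IsHamiltonianSystemWithSymmetry ω₁ J₁ μ₁ H₁)
    (ω₂ : TwoForm E₂ M₂) (J₂ : M₂ → Module.Dual ℝ (GroupLieAlgebra 𝓘(ℝ, EG₂) G₂))
    (μ₂ : Module.Dual ℝ (GroupLieAlgebra 𝓘(ℝ, EG₂) G₂)) (H₂ : M₂ → ℝ)
    (h₂ : IsHamiltonianSystemWithSymmetry ω₂ J₂ μ₂ H₂)
    -- the smooth structures of the level sets and of the reduced phase spaces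
    {EL₁ : Type*} [NormedAddCommGroup EL₁] [NormedSpace ℝ EL₁] [FiniteDimensional ℝ EL₁]
    [ChartedSpace EL₁ (MomentumLevel J₁ μ₁)]
    {EP₁ : Type*} [NormedAddCommGroup EP₁] [NormedSpace ℝ EP₁] [FiniteDimensional ℝ EP₁]
    [ChartedSpace EP₁ (ReducedSpace G₁ J₁ μ₁)]
    (hP₁ : IsReducedManifold E₁ EL₁ EP₁ G₁ J₁ μ₁)
    {EL₂ : Type*} [NormedAddCommGroup EL₂] [NormedSpace ℝ EL₂] [FiniteDimensional ℝ EL₂]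
    [ChartedSpace EL₂ (MomentumLevel J₂ μ₂)]
    {EP₂ : Type*} [NormedAddCommGroup EP₂] [NormedSpace ℝ EP₂] [FiniteDimensional ℝ EP₂]
    [ChartedSpace EP₂ (ReducedSpace G₂ J₂ μ₂)]
    (hP₂ : IsReducedManifold E₂ EL₂ EP₂ G₂ J₂ μ₂)
    -- the reduced phase spaces have the same dimension
    (hdim : Module.finrank ℝ EP₁ = Module.finrank ℝ EP₂)
    -- the smooth, equivariant, partially symplectic map `F`, with `H₁ = H₂ ∘ F`
    (F : MomentumLevel J₁ μ₁ → MomentumLevel J₂ μ₂)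
    (hF : ContMDiff 𝓘(ℝ, EL₁) 𝓘(ℝ, EL₂) ∞ F)
    (hequiv : MapsOrbitsIntoOrbits G₁ G₂ F)
    (hsymp : pullbackForm F (levelForm EL₂ ω₂ J₂ μ₂) = levelForm EL₁ ω₁ J₁ μ₁)
    (hH : ∀ x : MomentumLevel J₁ μ₁, H₁ x = H₂ (F x)) :
    let ωμ₁ : TwoForm EP₁ (ReducedSpace G₁ J₁ μ₁) := reducedForm EL₁ EP₁ G₁ ω₁ J₁ μ₁
    let ωμ₂ : TwoForm EP₂ (ReducedSpace G₂ J₂ μ₂) := reducedForm EL₂ EP₂ G₂ ω₂ J₂ μ₂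
    let Hμ₁ := reducedHamiltonian G₁ J₁ μ₁ H₁ h₁.hamiltonian_invariant
    let Hμ₂ := reducedHamiltonian G₂ J₂ μ₂ H₂ h₂.hamiltonian_invariant
    let Fhat := reducedMap F hequiv
    -- the induced 2-forms exist and are nondegenerate
    (IsReducedForm EL₁ G₁ ω₁ J₁ μ₁ ωμ₁ ∧ NondegenerateForm ωμ₁) ∧
    (IsReducedForm EL₂ G₂ ω₂ J₂ μ₂ ωμ₂ ∧ NondegenerateForm ωμ₂) ∧
    -- the induced map is a symplectic local diffeomorphism
    IsLocalDiffeomorph 𝓘(ℝ, EP₁) 𝓘(ℝ, EP₂) ∞ Fhat ∧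
    pullbackForm Fhat ωμ₂ = ωμ₁ ∧
    -- it maps solutions of the first reduced system to solutions of the second
    (∀ (γ : ℝ → ReducedSpace G₁ J₁ μ₁) (s : Set ℝ),
      IsMIntegralCurveOn γ (hamiltonianVectorField ωμ₁ Hμ₁) s →
      IsMIntegralCurveOn (Fhat ∘ γ) (hamiltonianVectorField ωμ₂ Hμ₂) s) ∧
    -- it maps orbits into orbits, and onto orbits when the solution exists for all time
    (∀ p, Fhat '' hamiltonianOrbit ωμ₁ Hμ₁ p ⊆ hamiltonianOrbit ωμ₂ Hμ₂ (Fhat p)) ∧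
    (∀ γ : ℝ → ReducedSpace G₁ J₁ μ₁,
      IsMIntegralCurve γ (hamiltonianVectorField ωμ₁ Hμ₁) →
      Fhat '' hamiltonianOrbit ωμ₁ Hμ₁ (γ 0) = hamiltonianOrbit ωμ₂ Hμ₂ (Fhat (γ 0))) := by
  intro ωμ₁ ωμ₂ Hμ₁ Hμ₂ Fhat
  have := hP₁.quotient_manifold
  have := hP₂.quotient_manifold
  have : CompleteSpace EP₁ := FiniteDimensional.complete ℝ EP₁
  have : CompleteSpace EP₂ := FiniteDimensional.complete ℝ EP₂
  have hη₁ : IsReducedForm EL₁ G₁ ω₁ J₁ μ₁ ωμ₁ := hP₁.isReducedForm_reducedForm h₁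
  have hη₂ : IsReducedForm EL₂ G₂ ω₂ J₂ μ₂ ωμ₂ := hP₂.isReducedForm_reducedForm h₂
  have hn₁ : NondegenerateForm ωμ₁ := hP₁.nondegenerateForm_of_isReducedForm h₁ hη₁
  have hn₂ : NondegenerateForm ωμ₂ := hP₂.nondegenerateForm_of_isReducedForm h₂ hη₂
  have hFhat : ContMDiff 𝓘(ℝ, EP₁) 𝓘(ℝ, EP₂) ∞ Fhat :=
    hP₁.contMDiff_of_comp_proj (hP₂.contMDiff_proj.comp hF)
  have hFhatd : MDifferentiable 𝓘(ℝ, EP₁) 𝓘(ℝ, EP₂) Fhat := hFhat.mdifferentiable (by simp)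
  have hpull : pullbackForm Fhat ωμ₂ = ωμ₁ := by
    refine TwoForm.ext_at fun p a b => ?_
    obtain ⟨l, rfl⟩ := Quotient.exists_rep p
    -- Tangent vectors of the quotient lift to the level set, where the identity becomes the
    -- hypothesis that `F` is partially symplectic.
    obtain ⟨u, rfl⟩ := hP₁.proj_surjective l a
    obtain ⟨v, rfl⟩ := hP₁.proj_surjective l b
    have hFl := hF.contMDiffAt.mdifferentiableAt (x := l) (by simp)
    have e1 := modelDeriv_comp l (g := Fhat) (hFhatd _) (hP₁.mdifferentiableAt_proj l)
    have e2 := modelDeriv_comp l (hP₂.mdifferentiableAt_proj (F l)) hFl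
    have e3 : Fhat ∘ reducedProj G₁ J₁ μ₁ = reducedProj G₂ J₂ μ₂ ∘ F := rfl
    rw [e3, e2] at e1
    have e4 : ∀ w, modelDeriv EP₁ EP₂ Fhat (reducedProj G₁ J₁ μ₁ l)
        (modelDeriv EL₁ EP₁ (reducedProj G₁ J₁ μ₁) l w) =
          modelDeriv EL₂ EP₂ (reducedProj G₂ J₂ μ₂) (F l) (modelDeriv EL₁ EL₂ F l w) :=
      fun w => (DFunLike.congr_fun e1 w).symm
    change (pullbackForm Fhat ωμ₂).at (reducedProj G₁ J₁ μ₁ l) _ =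
      ωμ₁.at (reducedProj G₁ J₁ μ₁ l) _
    rw [pullbackForm_at, e4, e4, hη₁.apply_proj, ← hsymp, pullbackForm_at, ← hη₂.apply_proj]
    rfl
  have hHF : Hμ₁ = Hμ₂ ∘ Fhat := by
    funext p
    obtain ⟨l, rfl⟩ := Quotient.exists_rep p
    exact hH l
  have hHμ₂ : ContMDiff 𝓘(ℝ, EP₂) 𝓘(ℝ, ℝ) ∞ Hμ₂ := hP₂.contMDiff_reducedHamiltonian h₂
  have hrel : ∀ p, mfderiv 𝓘(ℝ, EP₁) 𝓘(ℝ, EP₂) Fhat p (hamiltonianVectorField ωμ₁ Hμ₁ p) =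
      hamiltonianVectorField ωμ₂ Hμ₂ (Fhat p) := fun p =>
    hn₁.modelDeriv_hamiltonianField hdim hn₂ hpull (hFhatd p)
      (hHμ₂.contMDiffAt.mdifferentiableAt (by simp)) hHF
  have hcurve : ∀ (γ : ℝ → ReducedSpace G₁ J₁ μ₁) (s : Set ℝ),
      IsMIntegralCurveOn γ (hamiltonianVectorField ωμ₁ Hμ₁) s →
      IsMIntegralCurveOn (Fhat ∘ γ) (hamiltonianVectorField ωμ₂ Hμ₂) s := fun γ s hγ =>
    isMIntegralCurveOn_comp_of_related hFhatd hrel hγ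
  have horbit : ∀ p, Fhat '' hamiltonianOrbit ωμ₁ Hμ₁ p ⊆
      hamiltonianOrbit ωμ₂ Hμ₂ (Fhat p) := by
    rintro _ _ ⟨q, ⟨γ, a, b, t, h0, ht, hγ, hγ0, rfl⟩, rfl⟩
    exact ⟨Fhat ∘ γ, a, b, t, h0, ht, hcurve γ _ hγ, congrArg Fhat hγ0, rfl⟩
  refine ⟨⟨hη₁, hn₁⟩, ⟨hη₂, hn₂⟩, fun p => ?_, hpull, hcurve, horbit, fun γ hγ => ?_⟩
  · obtain ⟨A, hA⟩ := hn₁.exists_modelDeriv_equiv hdim hpull p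
    exact isLocalDiffeomorphAt_of_modelDeriv_eq isOpen_univ hFhat.contMDiffOn (Set.mem_univ p) A hA
  · refine (horbit _).antisymm ?_
    -- The global curve `γ` is defined on the whole interval of `δ`, so its image agrees with `δ`
    -- there by uniqueness; `γ t` is the required preimage.
    rintro _ ⟨δ, a, b, t, h0, ht, hδ, hδ0, rfl⟩
    have : T2Space (ReducedSpace G₂ J₂ μ₂) := t2Space_reducedSpace
    have : IsManifold 𝓘(ℝ, EP₂) 1 (ReducedSpace G₂ J₂ μ₂) := IsManifold.of_le (n := ∞) (by simp)
    have heq := isMIntegralCurveOn_Ioo_eqOn_of_contMDiff_boundaryless h0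
      (hP₂.contMDiff_hamiltonianVectorField h₂ hη₂ hHμ₂)
      (hcurve γ _ (hγ.isMIntegralCurveOn (Set.Ioo a b))) hδ hδ0.symm
    exact ⟨γ t, ⟨γ, a, b, t, h0, ht, hγ.isMIntegralCurveOn _, rfl, rfl⟩, heq ht⟩
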